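/- Units are chosen so that the speed of light and the particle mass are $1$. For $\zeta>0$ let $K_n(\zeta)=\int_0^\infty\cosh(n\vartheta)e^{-\zeta\cosh\vartheta}\,d\vartheta$ and, for $\ell=0,1$, let $\{P^{(\ell)}_n(\cdot\,;\zeta)\}_{n\ge 0}$ be the orthonormal polynomials with positive leading coefficients $c^{(\ell)}_n$ for the weight $\omega^{(\ell)}(x;\zeta)=\frac{(x^2-1)^{\ell-1/2}}{K_1(\zeta)}e^{-\zeta x}$ on $[1,\infty)$. For $|u|<1$ and $\theta>0$ put $\zeta=1/\theta$, $U^0=(1-u^2)^{-1/2}$, $U^1=uU^0$, $p^0=\sqrt{1+p^2}$, $E=U^0p^0-U^1p$, $p_{<1>}=-(p-EU^1)$, $g_{[u,\theta]}(p)=\frac{1}{2K_1(\zeta)}e^{-E/\theta}$, $\langle f,h\rangle=\int_{\mathbb R}\frac{1}{g_{[u,\theta]}}fh\,\frac{dp}{p^0}$, $\tilde P^{(0)}_n=g_{[u,\theta]}P^{(0)}_n(E;\zeta)$, $\tilde P^{(1)}_n=g_{[u,\theta]}(U^0)^{-1}P^{(1)}_n(E;\zeta)\,p_{<1>}$. Let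 $M\ge 1$, and let $\mathcal P_M[u,\theta]=(\tilde P^{(0)}_0,\tilde P^{(0)}_1,\tilde P^{(1)}_0,\dots,\tilde P^{(0)}_M,\tilde P^{(1)}_{M-1})^T$, an orthonormal system of $2M+1$ functions of $p$; let $\Pi_M[u,\theta]$ be the orthogonal projection onto its span. The unknown is $W=(\rho,u,\theta,\Pi,\tilde n^1,f^0_3,f^1_2,\dots,f^0_M,f^1_{M-1})^T\in\mathbb R^{2M+1}$ (only $(\rho,u,\theta)$ if $M=1$). The projected distribution function is $f_W=[\mathcal P_M[u,\theta],D^W_MW]$, where $[\cdot,\cdot]$ is the dot product and $D^W_M=D^W_M(\theta)$ expresses the expansion coefficients $(f^0_0,f^0_1,f^1_0,f^0_2,f^1_1,f^0_3,f^1_2,\dots)$ by $$f^0_0=\frac{\rho}{c^{(0)}_0}-\Pi\,P^{(0)}_0(0;\zeta),\quad f^0_i=-\Pi\,P^{(0)}_i(0;\zeta)\ (i=1,2),\quad f^1_j=-\tilde n^1P^{(1)}_j(0;\zeta)\ (j=0,1),$$ with $\Pi=\tilde n^1=0$ if $M=1$, and by the identity on the remaining components. Let $\tilde D^W_M$ be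 $D^W_M$ with its upper left entry replaced by $0$. Define the matrices $D_M(W)$, $M^t_M$, $M^x_M$ by $$(D_M)_{ij}=\Big\langle\frac{\partial f_W}{\partial W_j},(\mathcal P_M)_i\Big\rangle,\quad (M^t_M)_{ij}=\langle p^0(\mathcal P_M)_j,(\mathcal P_M)_i\rangle,\quad (M^x_M)_{ij}=\langle p\,(\mathcal P_M)_j,(\mathcal P_M)_i\rangle ,$$ and, with a relaxation time $\tau=\tau(\rho,\theta)$, $$B^0=M^t_MD_M,\qquad B^1=M^x_MD_M,\qquad Q_M=-\frac1\tau\big(U^0M^t_M-U^1M^x_M\big)\tilde D^W_M .$$ The moment system with the Anderson–Witting source term is $B^0(W)\partial_tW+B^1(W)\partial_xW=Q_M(W)W$, that is, $\Pi_M\big(p^0\,\Pi_M\partial_t f_W\big)+\Pi_M\big(p\,\Pi_M\partial_x f_W\big)=-\frac1\tau\Pi_M\big(E(f_W-\rho g_{[u,\theta]})\big)$. **Theorem.** The moment system is linearly stable at local equilibrium, both in time and in space. Precisely, let $M\ge1$, $\rho_0>0$, $|u_0|<1$, $\theta_0>0$, $\tau(\rho_0,\theta_0)>0$, and let $B^0,B^1,Q_M$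 be evaluated at $W^{(0)}=(\rho_0,u_0,\theta_0,0,\dots,0)^T$. Plane waves $\tilde W\exp(i(\omega t-kx))$, $\tilde W\neq0$, of the linearized system $B^0\partial_t\bar W+B^1\partial_x\bar W=Q_M\bar W$ satisfy the dispersion relation $$\det\big(i\omega B^0-ikB^1-Q_M\big)=0 .$$ (i) If $k\in\mathbb R$ and $\omega\in\mathbb C$ satisfy it, then $\operatorname{Im}\omega\ge0$. (ii) If $\omega>0$ is real and $k\in\mathbb C$ satisfies it, then $\operatorname{Re}k\cdot\operatorname{Im}k\le0$. -/

import Mathlib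

open scoped Polynomial

noncomputable section

namespace RelMoment

/- Units: speed of light and particle mass are one; `ζ = 1 / θ`. -/

/-- Modified Bessel function of the second kind `K_n`. -/
def besselK (n : ℕ) (ζ : ℝ) : ℝ :=
  ∫ ϑ in Set.Ioi (0 : ℝ), Real.cosh (n * ϑ) * Real.exp (-ζ * Real.cosh ϑ)

/-- The weight functions (`ℓ = 0, 1`) on `[1, ∞)`. -/
def weight (ℓ : ℕ) (ζ x : ℝ) : ℝ :=
  (x ^ 2 - 1) ^ ((ℓ : ℝ) - 1 / 2) / besselK 1 ζ * Real.exp (-ζ * x)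

/-- The inner product of two polynomials with respect to `weight ℓ ζ`. -/
def polyInner (ℓ : ℕ) (ζ : ℝ) (f g : ℝ[X]) : ℝ :=
  ∫ x in Set.Ioi (1 : ℝ), f.eval x * g.eval x * weight ℓ ζ x

/-- The orthonormal polynomials with positive leading coefficient for `weight ℓ ζ`:
the Gram-Schmidt process applied to `1, x, x², …`. -/
def orthoPoly (ℓ : ℕ) (ζ : ℝ) (n : ℕ) : ℝ[X] :=
  let q : ℝ[X] := Polynomial.X ^ n -
    ∑ k : Fin n, Polynomial.C (polyInner ℓ ζ (Polynomial.X ^ n) (orthoPoly ℓ ζ k)) *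
      orthoPoly ℓ ζ k
  Polynomial.C (1 / √(polyInner ℓ ζ q q)) * q
termination_by n
decreasing_by all_goals exact k.isLt

/-- `U⁰`, the Lorentz factor. -/
def U0 (u : ℝ) : ℝ := 1 / √(1 - u ^ 2)

/-- `U¹`. -/
def U1 (u : ℝ) : ℝ := u / √(1 - u ^ 2)

/-- `p⁰` on the mass shell. -/
def p0 (p : ℝ) : ℝ := √(1 + p ^ 2)

/-- `E = U_α p^α` with the metric `diag(1, -1)`. -/
def energy (u p : ℝ) : ℝ := U0 u * p0 p - U1 u * p

/-- `p_{<1>} = -p^{<1>}`, where `p^{<1>} = p¹ - E U¹`. -/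
def pBracket (u p : ℝ) : ℝ := -(p - energy u p * U1 u)

/-- The weight `g⁽⁰⁾_{[u,θ]}` (the local equilibrium of unit mass density). -/
def gEq (u θ p : ℝ) : ℝ := 1 / (2 * besselK 1 (1 / θ)) * Real.exp (-(energy u p / θ))

/-- The inner product `⟨f, h⟩_{g⁽⁰⁾_{[u,θ]}}`. -/
def gInner (u θ : ℝ) (f h : ℝ → ℝ) : ℝ :=
  ∫ p : ℝ, 1 / gEq u θ p * f p * h p / p0 p

/-- `P̃⁽⁰⁾_n[u,θ] = g⁽⁰⁾ P⁽⁰⁾_n(E)`. -/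
def basis0 (n : ℕ) (u θ p : ℝ) : ℝ :=
  gEq u θ p * (orthoPoly 0 (1 / θ) n).eval (energy u p)

/-- `P̃⁽¹⁾_n[u,θ] = g⁽⁰⁾ (U⁰)⁻¹ P⁽¹⁾_n(E) p_{<1>}`. -/
def basis1 (n : ℕ) (u θ p : ℝ) : ℝ :=
  gEq u θ p * (U0 u)⁻¹ * (orthoPoly 1 (1 / θ) n).eval (energy u p) * pBracket u p

/-- The basis, ordered as
`P̃⁽⁰⁾_0, P̃⁽⁰⁾_1, P̃⁽¹⁾_0, P̃⁽⁰⁾_2, P̃⁽¹⁾_1, …, P̃⁽⁰⁾_M, P̃⁽¹⁾_{M-1}` (positions `0, …, 2M`). -/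
def basisFn (i : ℕ) (u θ p : ℝ) : ℝ :=
  if i = 0 then basis0 0 u θ p
  else if i % 2 = 1 then basis0 ((i + 1) / 2) u θ p
  else basis1 (i / 2 - 1) u θ p

/-- The matrix expressing the expansion coefficients
`(f⁰_0, f⁰_1, f¹_0, f⁰_2, f¹_1, f⁰_3, f¹_2, …)` of the distribution function through
`W = (ρ, u, θ, Π, ñ¹, f⁰_3, f¹_2, …)`.  It comes from
`∫ f dp/p⁰ = ρ (c⁽⁰⁾_0)⁻² - Π`, `∫ E f dp/p⁰ = ρ`, `∫ E² f dp/p⁰ = ε₀(ρ, θ)`,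
`∫ p_{<1>} f dp/p⁰ = -n¹`, `∫ E p_{<1>} f dp/p⁰ = 0` and `ñ¹ = n¹ / U⁰`.
Here `P_n(0) = (-1)ⁿ c_n ∏ x_{i,n}`, the `x_{i,n}` being the zeros of `P_n` and `c_n` its
leading coefficient. -/
def coeffMatrix (M : ℕ) (θ : ℝ) : Matrix (Fin (2 * M + 1)) (Fin (2 * M + 1)) ℝ :=
  Matrix.of fun i j =>
    match (i : ℕ), (j : ℕ) with
    | 0, 0 => ((orthoPoly 0 (1 / θ) 0).leadingCoeff)⁻¹
    | 0, 3 => -(orthoPoly 0 (1 / θ) 0).eval 0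
    | 1, 3 => -(orthoPoly 0 (1 / θ) 1).eval 0
    | 3, 3 => -(orthoPoly 0 (1 / θ) 2).eval 0
    | 2, 4 => -(orthoPoly 1 (1 / θ) 0).eval 0
    | 4, 4 => -(orthoPoly 1 (1 / θ) 1).eval 0
    | a, b => if a = b ∧ 5 ≤ a then 1 else 0

/-- `coeffMatrix` with the upper left entry replaced by zero; `coeffMatrixTilde * W` is the
coefficient vector of `f - f⁽⁰⁾`. -/
def coeffMatrixTilde (M : ℕ) (θ : ℝ) : Matrix (Fin (2 * M + 1)) (Fin (2 * M + 1)) ℝ :=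
  Matrix.of fun i j => if (i : ℕ) = 0 ∧ (j : ℕ) = 0 then 0 else coeffMatrix M θ i j

/-- The projected distribution function `Π_M[u,θ] f` as a function of
`W = (ρ, u, θ, Π, ñ¹, f⁰_3, f¹_2, …)` and `p`. -/
def ansatz (M : ℕ) (W : Fin (2 * M + 1) → ℝ) (p : ℝ) : ℝ :=
  ∑ i : Fin (2 * M + 1), (coeffMatrix M (W 2)).mulVec W i * basisFn i (W 1) (W 2) p

/-- The matrix `D_M(W)`: column `j` holds the basis coefficients of the projection of
`∂/∂W_j` of the ansatz, so that
`Π_M ∂_s (Π_M f) = [𝒫_M, D_M ∂_s W]` for `s = t, x`. -/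
def matD (M : ℕ) (W : Fin (2 * M + 1) → ℝ) : Matrix (Fin (2 * M + 1)) (Fin (2 * M + 1)) ℝ :=
  Matrix.of fun i j =>
    gInner (W 1) (W 2)
      (fun p => deriv (fun s => ansatz M (Function.update W j s) p) (W j))
      (basisFn i (W 1) (W 2))

/-- The matrix `M^t_M` of `Π_M (p⁰ ·)` on the basis. -/
def matMt (M : ℕ) (u θ : ℝ) : Matrix (Fin (2 * M + 1)) (Fin (2 * M + 1)) ℝ :=
  Matrix.of fun i j => gInner u θ (fun p => p0 p * basisFn j u θ p) (basisFn i u θ)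

/-- The matrix `M^x_M` of `Π_M (p ·)` on the basis. -/
def matMx (M : ℕ) (u θ : ℝ) : Matrix (Fin (2 * M + 1)) (Fin (2 * M + 1)) ℝ :=
  Matrix.of fun i j => gInner u θ (fun p => p * basisFn j u θ p) (basisFn i u θ)

/-- `B⁰_M(W) = M^t_M D_M`. -/
def matB0 (M : ℕ) (W : Fin (2 * M + 1) → ℝ) : Matrix (Fin (2 * M + 1)) (Fin (2 * M + 1)) ℝ :=
  matMt M (W 1) (W 2) * matD M W

/-- `B¹_M(W) = M^x_M D_M`. -/
def matB1 (M : ℕ) (W : Fin (2 * M + 1) → ℝ) : Matrix (Fin (2 * M + 1)) (Fin (2 * M + 1)) ℝ :=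
  matMx M (W 1) (W 2) * matD M W

/-- `Q_M(W)` for the Anderson-Witting collision term with relaxation time `τ(ρ, θ)`;
the moment system is `B⁰(W) ∂_t W + B¹(W) ∂_x W = S(W)` with `S(W) = Q_M(W) W`. -/
def matQ (M : ℕ) (τ : ℝ → ℝ → ℝ) (W : Fin (2 * M + 1) → ℝ) :
    Matrix (Fin (2 * M + 1)) (Fin (2 * M + 1)) ℝ :=
  (-(1 / τ (W 0) (W 2))) •
    ((U0 (W 1) • matMt M (W 1) (W 2) - U1 (W 1) • matMx M (W 1) (W 2)) *
      coeffMatrixTilde M (W 2))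

/-- The local equilibrium state `(ρ₀, u₀, θ₀, 0, …, 0)`. -/
def equilibrium (M : ℕ) (ρ₀ u₀ θ₀ : ℝ) : Fin (2 * M + 1) → ℝ := fun i =>
  match (i : ℕ) with
  | 0 => ρ₀
  | 1 => u₀
  | 2 => θ₀
  | _ => 0

/-- The dispersion relation `det (iω B⁰ - ik B¹ - Q_M) = 0` of the linearized system
`B⁰ ∂_t V + B¹ ∂_x V = Q_M V` (coefficients frozen at the state `W`) for plane waves
`V = Ṽ exp (i (ω t - k x))`. -/
def DispersionRelation (M : ℕ) (τ : ℝ → ℝ → ℝ) (W : Fin (2 * M + 1) → ℝ) (ω k : ℂ) : Prop :=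
  ((Complex.I * ω) • (matB0 M W).map Complex.ofReal
    - (Complex.I * k) • (matB1 M W).map Complex.ofReal
    - (matQ M τ W).map Complex.ofReal).det = 0

end RelMoment

end

/-!
In the rest frame of the fluid, `p = sinh (y + rapidity u)` turns `E` into `cosh y` and the basis
into polynomials in `cosh y` and `sinh y`, orthonormal for the Jüttner density. Then `M^t` and `M^x`
are Gram matrices of the multiplications by `p⁰ ≥ 1` and `p`, so `M^t` is positive definite and
`M^x` symmetric, while `A = U⁰ M^t - U¹ M^x` is the positive semidefinite Gram matrix of `E`.

At equilibrium `D = D̃ + R`, where `R` holds the derivatives of the local equilibrium itself, which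
lie in the span of the collision invariants `P̃⁽⁰⁾_0`, `P̃⁽⁰⁾_1`, `P̃⁽¹⁾_0`. The columns of `D̃` are
built from the values at `0` of the orthonormal polynomials: by the reproducing property of
`∑ Pₙ(0) Pₙ`, testing them against `E` times an invariant gives the value at `0` of a multiple of
`x`, hence `Rᵀ A D̃ = 0`. Consequently `Dᵀ Q = -τ⁻¹ D̃ᵀ A D̃` is negative semidefinite, whereas
`Dᵀ B⁰ = Dᵀ M^t D` is positive definite and `Dᵀ B¹ = Dᵀ M^x D` symmetric. Pairing
`(iω Dᵀ B⁰ - ik Dᵀ B¹ - Dᵀ Q) w = 0` with `w` and comparing real and imaginary parts gives both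
claims.
-/

noncomputable section

namespace RelMoment

open MeasureTheory Matrix Asymptotics

section Stability

open scoped ComplexOrder MatrixOrder

variable {n : Type*}

theorem posSemidef_map_ofReal [Finite n] {S : Matrix n n ℝ} (hS : S.PosSemidef) :
    (S.map Complex.ofRealHom).PosSemidef := by
  classical
  cases nonempty_fintype n
  obtain ⟨B, rfl⟩ := CStarAlgebra.nonneg_iff_eq_star_mul_self.mp hS.nonneg
  rw [star_eq_conjTranspose, Matrix.map_mul, conjTranspose_map _ fun x => by simp]
  exact posSemidef_conjTranspose_mul_self _

theorem posDef_map_ofReal [Finite n] {S : Matrix n n ℝ} (hS : S.PosDef) :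
    (S.map Complex.ofRealHom).PosDef := by
  classical
  cases nonempty_fintype n
  exact (posSemidef_map_ofReal hS.posSemidef).posDef_iff_isUnit.2
    (hS.isUnit.map Complex.ofRealHom.mapMatrix)

variable [Fintype n] [DecidableEq n]

theorem exists_energy_identity {P H S : Matrix n n ℂ} (hP : P.PosDef) (hH : H.IsHermitian)
    (hS : S.PosSemidef) {ω k : ℂ}
    (hdet : ((Complex.I * ω) • P - (Complex.I * k) • H + S).det = 0) :
    ∃ p h s : ℝ, 0 < p ∧ 0 ≤ s ∧ ω.im * p = k.im * h + s ∧ ω.re * p = k.re * h := by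
  obtain ⟨w, hw0, hw⟩ := exists_mulVec_eq_zero_iff.2 hdet
  have hp := hP.dotProduct_mulVec_pos hw0
  have hs := hS.dotProduct_mulVec_nonneg w
  have hh : star w ⬝ᵥ H *ᵥ w = (star w ⬝ᵥ H *ᵥ w).re :=
    Complex.ext rfl (hH.im_star_dotProduct_mulVec_self w)
  have energy := congrArg (star w ⬝ᵥ ·) hw
  simp only [add_mulVec, sub_mulVec, smul_mulVec, dotProduct_add, dotProduct_sub, dotProduct_smul,
    smul_eq_mul, dotProduct_zero] at energy
  rw [hh, Complex.eq_re_of_ofReal_le hp.le, Complex.eq_re_of_ofReal_le hs] at energy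
  refine ⟨_, (star w ⬝ᵥ H *ᵥ w).re, _, (Complex.pos_iff.1 hp).1, (Complex.nonneg_iff.1 hs).1,
    ?_, ?_⟩
  · have hre := congrArg Complex.re energy
    simp only [Complex.add_re, Complex.sub_re, Complex.re_mul_ofReal, Complex.I_mul_re,
      Complex.ofReal_re, Complex.zero_re] at hre
    linarith
  · have him := congrArg Complex.im energy
    simp only [Complex.add_im, Complex.sub_im, Complex.im_mul_ofReal, Complex.I_mul_im,
      Complex.ofReal_im, Complex.zero_im] at him
    linarith

theorem im_nonneg_of_det_eq_zero {P H S : Matrix n n ℂ} (hP : P.PosDef) (hH : H.IsHermitian)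
    (hS : S.PosSemidef) {ω : ℂ} {k : ℝ}
    (hdet : ((Complex.I * ω) • P - (Complex.I * k) • H + S).det = 0) : 0 ≤ ω.im := by
  obtain ⟨p, h, s, hp, hs, hdecay, -⟩ := exists_energy_identity hP hH hS hdet
  rw [Complex.ofReal_im, zero_mul, zero_add] at hdecay
  exact nonneg_of_mul_nonneg_left (hdecay ▸ hs) hp

theorem re_mul_im_nonpos_of_det_eq_zero {P H S : Matrix n n ℂ} (hP : P.PosDef)
    (hH : H.IsHermitian) (hS : S.PosSemidef) {ω : ℝ} (hω : 0 < ω) {k : ℂ}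
    (hdet : ((Complex.I * ω) • P - (Complex.I * k) • H + S).det = 0) : k.re * k.im ≤ 0 := by
  obtain ⟨p, h, s, hp, hs, hdecay, hosc⟩ := exists_energy_identity hP hH hS hdet
  rw [Complex.ofReal_im, zero_mul] at hdecay
  rw [Complex.ofReal_re] at hosc
  have hh : 0 < h ^ 2 := by
    refine sq_pos_of_ne_zero ?_
    rintro rfl
    exact (mul_pos hω hp).ne' (by rw [hosc, mul_zero])
  have hprod : (k.re * k.im) * h ^ 2 = -(ω * p * s) := by
    linear_combination s * hosc - k.re * h * hdecay
  exact nonpos_of_mul_nonpos_left (hprod ▸ neg_nonpos.2 (by positivity)) hh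

theorem det_symmetrized_eq_zero {B₀ B₁ D Q : Matrix n n ℝ} {ω k : ℂ}
    (hdet : ((Complex.I * ω) • B₀.map Complex.ofReal - (Complex.I * k) • B₁.map Complex.ofReal -
      Q.map Complex.ofReal).det = 0) :
    ((Complex.I * ω) • (Dᵀ * B₀).map Complex.ofRealHom -
      (Complex.I * k) • (Dᵀ * B₁).map Complex.ofRealHom +
        (-(Dᵀ * Q)).map Complex.ofRealHom).det = 0 := by
  have hneg : (-(Dᵀ * Q)).map Complex.ofRealHom = -(Dᵀ * Q).map Complex.ofRealHom :=
    Matrix.map_neg _ (map_neg _) _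
  rw [hneg, Matrix.map_mul, Matrix.map_mul, Matrix.map_mul, ← mul_smul_comm, ← mul_smul_comm,
    ← sub_eq_add_neg, ← mul_sub, ← mul_sub, det_mul]
  exact mul_eq_zero_of_right _ hdet

end Stability

theorem isBigO_exp_mul_cosh_of_le {b c : ℝ} (h : b ≤ c) :
    (fun y => Real.exp (b * Real.cosh y)) =O[⊤] fun y => Real.exp (c * Real.cosh y) :=
  isBigO_top.2 ⟨1, fun y => by
    have := Real.cosh_pos y
    simp only [Real.norm_eq_abs, Real.abs_exp, one_mul]
    gcongr⟩

/-- Continuous functions of subexponential growth in `cosh`, as functions of the rapidity `y` (so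
`p = sinh y` and `p⁰ = cosh y`); they are integrable against every weight `exp (-ζ cosh y)`. -/
def rapidityAlgebra : Subalgebra ℝ (ℝ → ℝ) where
  carrier := {F | Continuous F ∧ ∀ b > 0, F =O[⊤] fun y => Real.exp (b * Real.cosh y)}
  mul_mem' {F G} hF hG := ⟨hF.1.mul hG.1, fun b hb => by
    refine ((hF.2 _ (half_pos hb)).mul (hG.2 _ (half_pos hb))).congr_right fun y => ?_
    rw [← Real.exp_add, ← add_mul, add_halves]⟩
  add_mem' {F G} hF hG := ⟨hF.1.add hG.1, fun b hb => (hF.2 b hb).add (hG.2 b hb)⟩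
  algebraMap_mem' c := ⟨continuous_const, fun b hb =>
    (isBigO_const_const c (one_ne_zero (α := ℝ)) ⊤).trans <| by
      simpa using isBigO_exp_mul_cosh_of_le hb.le⟩

theorem mem_rapidityAlgebra {F : ℝ → ℝ} : F ∈ rapidityAlgebra ↔
    Continuous F ∧ ∀ b > 0, F =O[⊤] fun y => Real.exp (b * Real.cosh y) :=
  Iff.rfl

namespace rapidityAlgebra

@[fun_prop] theorem continuous (F : rapidityAlgebra) : Continuous (F : ℝ → ℝ) :=
  (mem_rapidityAlgebra.1 F.2).1

theorem isBigO (F : rapidityAlgebra) {b : ℝ} (hb : 0 < b) :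
    (F : ℝ → ℝ) =O[⊤] fun y => Real.exp (b * Real.cosh y) :=
  (mem_rapidityAlgebra.1 F.2).2 b hb

theorem cosh_mem : Real.cosh ∈ rapidityAlgebra := by
  refine mem_rapidityAlgebra.2 ⟨Real.continuous_cosh, fun b hb => isBigO_top.2 ⟨b⁻¹, fun y => ?_⟩⟩
  have := Real.add_one_le_exp (b * Real.cosh y)
  rw [Real.norm_of_nonneg (Real.cosh_pos y).le, Real.norm_of_nonneg (Real.exp_pos _).le,
    inv_mul_eq_div, le_div_iff₀' hb]
  linarith

theorem sinh_mem : Real.sinh ∈ rapidityAlgebra :=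
  mem_rapidityAlgebra.2 ⟨Real.continuous_sinh, fun b hb => .trans (isBigO_top.2 ⟨1, fun y => by
    rw [one_mul, Real.norm_eq_abs, Real.norm_eq_abs, ← sq_le_sq, Real.cosh_sq]
    linarith⟩) ((mem_rapidityAlgebra.1 cosh_mem).2 b hb)⟩

/-- The hyperbolic cosine, that is, the energy `p⁰`, in `rapidityAlgebra`. -/
def cosh : rapidityAlgebra := ⟨Real.cosh, cosh_mem⟩

/-- The hyperbolic sine, that is, the momentum `p`, in `rapidityAlgebra`. -/
def sinh : rapidityAlgebra := ⟨Real.sinh, sinh_mem⟩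

@[simp] theorem cosh_apply (y : ℝ) : (cosh : ℝ → ℝ) y = Real.cosh y := rfl

@[simp] theorem sinh_apply (y : ℝ) : (sinh : ℝ → ℝ) y = Real.sinh y := rfl

end rapidityAlgebra

theorem sq_div_four_le_cosh (y : ℝ) : y ^ 2 / 4 ≤ Real.cosh y := by
  have hquad := Real.quadratic_le_exp_of_nonneg (abs_nonneg y)
  rw [sq_abs] at hquad
  rw [← Real.cosh_abs, Real.cosh_eq]
  linarith [abs_nonneg y, Real.exp_pos (-|y|)]

theorem integrable_exp_neg_mul_cosh {b : ℝ} (hb : 0 < b) :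
    Integrable fun y : ℝ => Real.exp (-b * Real.cosh y) := by
  refine (integrable_exp_neg_mul_sq (b := b / 4) (by positivity)).mono' (by fun_prop)
    (.of_forall fun y => ?_)
  rw [Real.norm_eq_abs, Real.abs_exp, Real.exp_le_exp]
  nlinarith [sq_div_four_le_cosh y]

theorem integrable_mul_exp_neg_mul_cosh (F : rapidityAlgebra) {b : ℝ} (hb : 0 < b) :
    Integrable fun y : ℝ => (F : ℝ → ℝ) y * Real.exp (-b * Real.cosh y) := by
  have hdom : (fun y => (F : ℝ → ℝ) y * Real.exp (-b * Real.cosh y)) =O[⊤]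
      fun y => Real.exp (-(b / 2) * Real.cosh y) := by
    refine ((rapidityAlgebra.isBigO F (half_pos hb)).mul (isBigO_refl _ ⊤)).congr_right fun y => ?_
    rw [← Real.exp_add]
    ring_nf
  exact hdom.integrable (by fun_prop) (integrable_exp_neg_mul_cosh (half_pos hb))

theorem p0_sinh (y : ℝ) : p0 (Real.sinh y) = Real.cosh y := by
  rw [p0, add_comm, ← Real.cosh_sq, Real.sqrt_sq (Real.cosh_pos y).le]

theorem integrable_iff_integrable_sinh {F : ℝ → ℝ} :
    Integrable F ↔ Integrable fun y => Real.cosh y * F (Real.sinh y) := by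
  have h := integrableOn_image_iff_integrableOn_abs_deriv_smul MeasurableSet.univ
    (fun y _ => (Real.hasDerivAt_sinh y).hasDerivWithinAt) Real.sinh_injective.injOn F
  simpa only [Set.image_univ, Real.sinh_surjective.range_eq, integrableOn_univ,
    abs_of_pos (Real.cosh_pos _), smul_eq_mul] using h

theorem integral_eq_integral_sinh (F : ℝ → ℝ) :
    ∫ p, F p = ∫ y, Real.cosh y * F (Real.sinh y) := by
  have h := integral_image_eq_integral_abs_deriv_smul MeasurableSet.univ
    (fun y _ => (Real.hasDerivAt_sinh y).hasDerivWithinAt) Real.sinh_injective.injOn F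
  simpa only [Set.image_univ, Real.sinh_surjective.range_eq, setIntegral_univ,
    abs_of_pos (Real.cosh_pos _), smul_eq_mul] using h

theorem integral_div_p0 (F : ℝ → ℝ) : ∫ p, F p / p0 p = ∫ y, F (Real.sinh y) := by
  rw [integral_eq_integral_sinh]
  refine integral_congr_ae (.of_forall fun y => ?_)
  have := (Real.cosh_pos y).ne'
  simp only [p0_sinh]
  field_simp

theorem two_mul_besselK_one_eq_mgf (ζ : ℝ) :
    2 * besselK 1 ζ = ProbabilityTheory.mgf (fun p => -p0 p) volume ζ := by
  have h := integral_comp_abs (f := fun y => Real.cosh y * Real.exp (-ζ * Real.cosh y))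
  simp only [Real.cosh_abs, neg_mul] at h
  rw [ProbabilityTheory.mgf, integral_eq_integral_sinh]
  simp only [p0_sinh, besselK, Nat.cast_one, one_mul, ← h, mul_neg, neg_mul]

theorem Ioi_subset_integrableExpSet_neg_p0 :
    Set.Ioi 0 ⊆ ProbabilityTheory.integrableExpSet (fun p => -p0 p) volume := fun ζ hζ => by
  refine integrable_iff_integrable_sinh.2 ?_
  simpa only [p0_sinh, rapidityAlgebra.cosh_apply, mul_neg, neg_mul] using
    integrable_mul_exp_neg_mul_cosh rapidityAlgebra.cosh hζ

theorem besselK_one_pos {ζ : ℝ} (hζ : 0 < ζ) : 0 < besselK 1 ζ := by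
  have h := ProbabilityTheory.mgf_pos' (NeZero.ne (volume : Measure ℝ))
    (Ioi_subset_integrableExpSet_neg_p0 hζ)
  rwa [← two_mul_besselK_one_eq_mgf, mul_pos_iff_of_pos_left two_pos] at h

theorem differentiableAt_besselK_one {ζ : ℝ} (hζ : 0 < ζ) : DifferentiableAt ℝ (besselK 1) ζ := by
  have h := ProbabilityTheory.differentiableAt_mgf
    (interior_maximal Ioi_subset_integrableExpSet_neg_p0 isOpen_Ioi hζ)
  refine (h.div_const 2).congr_of_eventuallyEq (.of_forall fun z => ?_)
  exact eq_div_of_mul_eq two_ne_zero (by rw [mul_comm, two_mul_besselK_one_eq_mgf])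

/-- The Maxwell-Jüttner distribution `g` of unit mass density in the rapidity variable of the
comoving frame. -/
def juttner (ζ y : ℝ) : ℝ := 1 / (2 * besselK 1 ζ) * Real.exp (-ζ * Real.cosh y)

@[fun_prop] theorem continuous_juttner (ζ : ℝ) : Continuous (juttner ζ) := by
  unfold juttner
  fun_prop

theorem juttner_pos {ζ : ℝ} (hζ : 0 < ζ) (y : ℝ) : 0 < juttner ζ y := by
  have := besselK_one_pos hζ
  unfold juttner
  positivity

theorem juttner_neg (ζ y : ℝ) : juttner ζ (-y) = juttner ζ y := by
  rw [juttner, juttner, Real.cosh_neg]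

section RapidityIntegral

variable {ζ : ℝ} (hζ : 0 < ζ)

include hζ in
theorem integrable_mul_juttner (F : rapidityAlgebra) :
    Integrable fun y => (F : ℝ → ℝ) y * juttner ζ y := by
  refine ((integrable_mul_exp_neg_mul_cosh F hζ).const_mul (1 / (2 * besselK 1 ζ))).congr
    (.of_forall fun y => ?_)
  simp only [juttner]
  ring

/-- The rapidity integral `F ↦ ∫ F(y) g(y) dy`. -/
def rapidityIntegral : rapidityAlgebra →ₗ[ℝ] ℝ where
  toFun F := ∫ y, (F : ℝ → ℝ) y * juttner ζ y
  map_add' F G := by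
    simpa only [Subalgebra.coe_add, Pi.add_apply, add_mul] using
      integral_add (integrable_mul_juttner hζ F) (integrable_mul_juttner hζ G)
  map_smul' c F := by
    simpa only [Subalgebra.coe_smul, Pi.smul_apply, smul_eq_mul, mul_assoc,
      RingHom.id_apply] using
      integral_const_mul c fun y => (F : ℝ → ℝ) y * juttner ζ y

theorem rapidityIntegral_apply (F : rapidityAlgebra) :
    rapidityIntegral hζ F = ∫ y, (F : ℝ → ℝ) y * juttner ζ y := rfl

theorem rapidityIntegral_nonneg {F : rapidityAlgebra} (hF : ∀ y, 0 ≤ (F : ℝ → ℝ) y) :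
    0 ≤ rapidityIntegral hζ F :=
  integral_nonneg fun y => mul_nonneg (hF y) (juttner_pos hζ y).le

theorem rapidityIntegral_pos {F : rapidityAlgebra} (hF : ∀ y, 0 ≤ (F : ℝ → ℝ) y) {x : ℝ}
    (hx : (F : ℝ → ℝ) x ≠ 0) : 0 < rapidityIntegral hζ F :=
  integral_pos_of_integrable_nonneg_nonzero (by fun_prop) (integrable_mul_juttner hζ F)
    (fun y => mul_nonneg (hF y) (juttner_pos hζ y).le) (mul_ne_zero hx (juttner_pos hζ x).ne')

theorem rapidityIntegral_eq_zero_of_odd {F : rapidityAlgebra}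
    (hF : ∀ y, (F : ℝ → ℝ) (-y) = -(F : ℝ → ℝ) y) : rapidityIntegral hζ F = 0 := by
  have h := integral_neg_eq_self (fun y => (F : ℝ → ℝ) y * juttner ζ y) volume
  simp only [hF, juttner_neg, neg_mul, integral_neg] at h
  exact self_eq_neg.1 h.symm

end RapidityIntegral

section OrthonormalSequence

open Polynomial

/-- The polynomials `P n` are orthonormal for the moment functional `L`. -/
def IsOrthonormalFor {K : Type*} [Field K] (L : K[X] →ₗ[K] K) (P : ℕ → K[X]) : Prop :=
  ∀ m n, L (P m * P n) = if m = n then 1 else 0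

namespace IsOrthonormalFor

variable {K : Type*} [Field K] {L : K[X] →ₗ[K] K} {P : Polynomial.Sequence K}

theorem sum_smul_eq (hP : IsOrthonormalFor L P) {n : ℕ} {f : K[X]} (hf : f.degree < n) :
    ∑ k ∈ Finset.range n, L (f * P k) • P k = f := by
  have hspan : f ∈ Submodule.span K (P '' Set.Iio n) := by
    rw [P.span_degreeLT fun i _ => by simp]
    exact mem_degreeLT.2 hf
  clear hf
  induction hspan using Submodule.span_induction with
  | mem _ h =>
    obtain ⟨i, hi, rfl⟩ := h
    rw [Finset.sum_eq_single_of_mem i (Finset.mem_range.2 hi) fun k _ hk => by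
      rw [hP, if_neg hk.symm, zero_smul], hP, if_pos rfl, one_smul]
  | zero => simp
  | add f g _ _ ihf ihg => simp [add_mul, add_smul, Finset.sum_add_distrib, ihf, ihg]
  | smul c f _ ih => simp [mul_smul, ← Finset.smul_sum, ih]

theorem apply_mul_eq_zero (hP : IsOrthonormalFor L P) {n : ℕ} {f : K[X]} (hf : f.degree < n) :
    L (f * P n) = 0 := by
  rw [← hP.sum_smul_eq hf, Finset.sum_mul, map_sum]
  refine Finset.sum_eq_zero fun k hk => ?_
  rw [smul_mul_assoc, map_smul, hP, if_neg (Finset.mem_range.1 hk).ne, smul_zero]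

/-- The reproducing property of the Christoffel-Darboux kernel `∑ P k (x) P k (y)`. -/
theorem sum_mul_eval_eq (hP : IsOrthonormalFor L P) {n : ℕ} {f : K[X]} (hf : f.degree < n)
    (x : K) : ∑ k ∈ Finset.range n, L (f * P k) * (P k).eval x = f.eval x := by
  conv_rhs => rw [← hP.sum_smul_eq hf]
  simp [eval_finsetSum]

theorem eval_ne_zero (hP : IsOrthonormalFor L P) {x : K}
    (hL : ∀ q ≠ 0, L ((X - C x) * q * q) ≠ 0) (n : ℕ) : (P n).eval x ≠ 0 := by
  intro hx
  obtain ⟨q, hq⟩ := dvd_iff_isRoot.2 hx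
  have hq0 : q ≠ 0 := right_ne_zero_of_mul (hq ▸ P.ne_zero n)
  have hdeg : q.degree < n := by
    rw [← P.degree_eq n, hq, mul_comm, degree_mul, degree_X_sub_C, degree_eq_natDegree hq0]
    exact_mod_cast Nat.lt_succ_self _
  exact hL q hq0 (by rw [← hq, mul_comm, hP.apply_mul_eq_zero hdeg])

end IsOrthonormalFor

/-- The unnormalized `n`-th step of the Gram-Schmidt process for the moment functional `L` and the
monomials, given the results `P k` of the steps `k < n`. -/
def gramSchmidtStep (L : ℝ[X] →ₗ[ℝ] ℝ) (P : ℕ → ℝ[X]) (n : ℕ) : ℝ[X] :=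
  X ^ n - ∑ k : Fin n, C (L (X ^ n * P k)) * P k

variable {L : ℝ[X] →ₗ[ℝ] ℝ} {P : ℕ → ℝ[X]}

theorem degree_gramSchmidtStep {n : ℕ} (hP : ∀ k < n, (P k).degree ≤ k) :
    (gramSchmidtStep L P n).degree = n := by
  have hlower : (∑ k : Fin n, C (L (X ^ n * P k)) * P k).degree < n := by
    refine (degree_sum_le _ _).trans_lt ((Finset.sup_lt_iff (WithBot.bot_lt_coe n)).2 fun k _ => ?_)
    rw [← smul_eq_C_mul]
    exact (degree_smul_le _ _).trans_lt ((hP k k.2).trans_lt (Nat.cast_lt.2 k.2))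
  rw [gramSchmidtStep, degree_sub_eq_left_of_degree_lt (by rwa [degree_X_pow]), degree_X_pow]

variable (hL : ∀ f ≠ 0, 0 < L (f * f))
  (hP : ∀ n, P n = C (1 / √(L (gramSchmidtStep L P n * gramSchmidtStep L P n))) *
    gramSchmidtStep L P n)

include hP in
theorem degree_gramSchmidtStep_of_normalized (n : ℕ) : (gramSchmidtStep L P n).degree = n := by
  induction n using Nat.strong_induction_on with
  | _ n ih =>
    refine degree_gramSchmidtStep fun k hk => ?_
    rw [hP, ← smul_eq_C_mul]
    exact (degree_smul_le _ _).trans (ih k hk).le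

include hP hL

theorem gramSchmidtStep_self_pos (n : ℕ) :
    0 < L (gramSchmidtStep L P n * gramSchmidtStep L P n) :=
  hL _ (degree_ne_bot.1 (by simp [degree_gramSchmidtStep_of_normalized hP n]))

theorem degree_eq_of_gramSchmidt (n : ℕ) : (P n).degree = n := by
  have := gramSchmidtStep_self_pos hL hP n
  rw [hP, degree_C_mul (by positivity), degree_gramSchmidtStep_of_normalized hP]

theorem apply_mul_self_of_gramSchmidt (n : ℕ) : L (P n * P n) = 1 := by
  have hpos := gramSchmidtStep_self_pos hL hP n
  rw [hP, ← smul_eq_C_mul, smul_mul_smul_comm, map_smul, div_mul_div_comm,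
    Real.mul_self_sqrt hpos.le, smul_eq_mul, one_mul, one_div_mul_cancel hpos.ne']

theorem apply_mul_of_gramSchmidt_of_lt {m n : ℕ} (hmn : m < n) : L (P m * P n) = 0 := by
  induction n using Nat.strong_induction_on generalizing m with
  | _ n ih =>
    have hother : ∀ k : Fin n, k ≠ ⟨m, hmn⟩ → L (P m * P k) = 0 := fun k hk => by
      rcases lt_or_gt_of_ne (Fin.val_ne_of_ne hk) with h | h
      · rw [mul_comm, ih m hmn h]
      · exact ih k k.2 h
    suffices L (P m * gramSchmidtStep L P n) = 0 by
      rw [hP n, ← smul_eq_C_mul, mul_smul_comm, map_smul, this, smul_zero]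
    simp only [gramSchmidtStep, ← smul_eq_C_mul, mul_sub, Finset.mul_sum, mul_smul_comm, map_sub,
      map_sum, map_smul]
    rw [Finset.sum_eq_single_of_mem ⟨m, hmn⟩ (Finset.mem_univ _) fun k _ hk => by
      rw [hother k hk, smul_zero], apply_mul_self_of_gramSchmidt hL hP, smul_eq_mul, mul_one,
      mul_comm, sub_self]

theorem isOrthonormalFor_of_gramSchmidt : IsOrthonormalFor L P := fun m n => by
  rcases lt_trichotomy m n with h | rfl | h
  · rw [apply_mul_of_gramSchmidt_of_lt hL hP h, if_neg h.ne]
  · rw [apply_mul_self_of_gramSchmidt hL hP, if_pos rfl]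
  · rw [mul_comm, apply_mul_of_gramSchmidt_of_lt hL hP h, if_neg h.ne']

end OrthonormalSequence

section MomentFunctional

open Polynomial

/-- The polynomials in `cosh`, that is, in the energy of the comoving frame. -/
def evalCosh : ℝ[X] →ₐ[ℝ] rapidityAlgebra := aeval rapidityAlgebra.cosh

@[simp] theorem evalCosh_apply (f : ℝ[X]) (y : ℝ) :
    (evalCosh f : ℝ → ℝ) y = f.eval (Real.cosh y) := by
  rw [evalCosh, aeval_subalgebra_coe, aeval_fn_apply, coe_aeval_eq_eval]
  rfl

variable (ℓ : ℕ) {ζ : ℝ} (hζ : 0 < ζ)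

/-- The moment functional `f ↦ ∫ f ω` of the weight `ω = weight ℓ ζ`, expressed through the
substitution `x = cosh y`. -/
def moment : ℝ[X] →ₗ[ℝ] ℝ :=
  rapidityIntegral hζ ∘ₗ LinearMap.mulRight ℝ (rapidityAlgebra.sinh ^ (2 * ℓ)) ∘ₗ
    evalCosh.toLinearMap

theorem moment_apply (f : ℝ[X]) :
    moment ℓ hζ f = rapidityIntegral hζ (evalCosh f * rapidityAlgebra.sinh ^ (2 * ℓ)) := rfl

theorem cosh_bijOn_Ioi : Set.BijOn Real.cosh (Set.Ioi 0) (Set.Ioi 1) := by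
  simpa using Real.cosh_bijOn.sdiff_singleton (Set.self_mem_Ici (a := (0 : ℝ)))

theorem sinh_mul_weight_cosh {y : ℝ} (hy : 0 < y) :
    Real.sinh y * weight ℓ ζ (Real.cosh y) = 2 * (Real.sinh y ^ (2 * ℓ) * juttner ζ y) := by
  have hs : 0 < Real.sinh y := Real.sinh_pos_iff.2 hy
  have hpow : Real.sinh y * (Real.cosh y ^ 2 - 1) ^ ((ℓ : ℝ) - 1 / 2) = Real.sinh y ^ (2 * ℓ) := by
    rw [← Real.sinh_sq, ← Real.rpow_natCast_mul hs.le, mul_comm, ← Real.rpow_add_one hs.ne',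
      ← Real.rpow_natCast]
    push_cast
    ring_nf
  rw [weight, juttner, ← hpow]
  ring

theorem polyInner_eq_moment (f h : ℝ[X]) : polyInner ℓ ζ f h = moment ℓ hζ (f * h) := by
  set F : ℝ → ℝ := fun y =>
    (f * h).eval (Real.cosh y) * Real.sinh y ^ (2 * ℓ) * juttner ζ y with hF
  have heven : ∀ y, F |y| = F y := fun y => by
    simp only [hF, juttner, Real.cosh_abs, ← Real.abs_sinh, (even_two_mul ℓ).pow_abs]
  calc polyInner ℓ ζ f h
    _ = ∫ y in Set.Ioi 0, 2 * F y := by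
      rw [polyInner, ← cosh_bijOn_Ioi.image_eq, integral_image_eq_integral_abs_deriv_smul
        measurableSet_Ioi (fun y _ => (Real.hasDerivAt_cosh y).hasDerivWithinAt)
        cosh_bijOn_Ioi.injOn]
      refine setIntegral_congr_fun measurableSet_Ioi fun y hy => ?_
      simp only [smul_eq_mul, abs_of_pos (Real.sinh_pos_iff.2 hy), hF, eval_mul]
      linear_combination f.eval (Real.cosh y) * h.eval (Real.cosh y) * sinh_mul_weight_cosh ℓ hy
    _ = ∫ y, F y := by
      rw [integral_const_mul, ← integral_comp_abs]
      simp only [heven]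
    _ = moment ℓ hζ (f * h) := by
      simp [moment_apply, rapidityIntegral_apply, hF]

theorem moment_pos {f : ℝ[X]} (hf : f ≠ 0) (hpos : ∀ x, 1 ≤ x → 0 ≤ f.eval x) :
    0 < moment ℓ hζ f := by
  obtain ⟨x, hx, hroot⟩ := (Set.Ioi_infinite (1 : ℝ)).exists_notMem_finite
    (f.rootSet_finite ℝ)
  rw [← cosh_bijOn_Ioi.image_eq] at hx
  obtain ⟨y, hy, rfl⟩ := hx
  have hfy : f.eval (Real.cosh y) ≠ 0 := fun h => hroot (mem_rootSet.2 ⟨hf, by simpa using h⟩)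
  refine rapidityIntegral_pos hζ (fun z => ?_) (x := y) ?_
  · simpa using mul_nonneg (hpos _ (Real.one_le_cosh z)) ((even_two_mul ℓ).pow_nonneg _)
  · simpa using ⟨hfy, fun h => absurd h (ne_of_gt hy)⟩

theorem moment_mul_self_pos {f : ℝ[X]} (hf : f ≠ 0) : 0 < moment ℓ hζ (f * f) :=
  moment_pos ℓ hζ (mul_ne_zero hf hf) fun x _ => by simpa using mul_self_nonneg (f.eval x)

include hζ in
theorem orthoPoly_eq_gramSchmidtStep (n : ℕ) :
    orthoPoly ℓ ζ n = C (1 / √(moment ℓ hζ (gramSchmidtStep (moment ℓ hζ) (orthoPoly ℓ ζ) n *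
      gramSchmidtStep (moment ℓ hζ) (orthoPoly ℓ ζ) n))) *
        gramSchmidtStep (moment ℓ hζ) (orthoPoly ℓ ζ) n := by
  rw [orthoPoly]
  simp only [polyInner_eq_moment ℓ hζ, gramSchmidtStep]

/-- The orthonormal polynomials of `weight ℓ ζ`, as a sequence indexed by the degree. -/
def orthoSequence : Polynomial.Sequence ℝ where
  elems' := orthoPoly ℓ ζ
  degree_eq' := degree_eq_of_gramSchmidt (fun _ => moment_mul_self_pos ℓ hζ)
    (orthoPoly_eq_gramSchmidtStep ℓ hζ)

theorem orthoSequence_apply (n : ℕ) : orthoSequence ℓ hζ n = orthoPoly ℓ ζ n := rfl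

theorem isOrthonormalFor_orthoSequence :
    IsOrthonormalFor (moment ℓ hζ) (orthoSequence ℓ hζ) :=
  isOrthonormalFor_of_gramSchmidt (fun _ => moment_mul_self_pos ℓ hζ)
    (orthoPoly_eq_gramSchmidtStep ℓ hζ)

include hζ in
theorem eval_zero_orthoPoly_ne_zero (n : ℕ) : (orthoPoly ℓ ζ n).eval 0 ≠ 0 :=
  (isOrthonormalFor_orthoSequence ℓ hζ).eval_ne_zero (fun q hq => (moment_pos ℓ hζ
    (by simpa using hq) fun x hx => by
      simpa [mul_assoc] using mul_nonneg (zero_le_one.trans hx) (mul_self_nonneg _)).ne') n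

end MomentFunctional

section Rapidity

/-- The rapidity of the velocity `u`. -/
def rapidity (u : ℝ) : ℝ := Real.arsinh (U1 u)

theorem sinh_rapidity (u : ℝ) : Real.sinh (rapidity u) = U1 u :=
  Real.sinh_arsinh _

variable {u : ℝ} (hu : |u| < 1)
include hu

theorem one_sub_sq_pos : 0 < 1 - u ^ 2 := by
  rwa [sub_pos, sq_lt_one_iff_abs_lt_one]

theorem cosh_rapidity : Real.cosh (rapidity u) = U0 u := by
  have h := one_sub_sq_pos hu
  rw [rapidity, Real.cosh_arsinh, U0, U1, div_pow, Real.sq_sqrt h.le, one_add_div h.ne',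
    sub_add_cancel, Real.sqrt_div' _ h.le, Real.sqrt_one]

theorem U0_pos : 0 < U0 u := cosh_rapidity hu ▸ Real.cosh_pos _

theorem U0_sq_sub_U1_sq : U0 u ^ 2 - U1 u ^ 2 = 1 := by
  rw [← cosh_rapidity hu, ← sinh_rapidity, Real.cosh_sq_sub_sinh_sq]

theorem cosh_add_rapidity (y : ℝ) :
    Real.cosh (y + rapidity u) = U0 u * Real.cosh y + U1 u * Real.sinh y := by
  rw [Real.cosh_add, cosh_rapidity hu, sinh_rapidity]
  ring

theorem sinh_add_rapidity (y : ℝ) :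
    Real.sinh (y + rapidity u) = U0 u * Real.sinh y + U1 u * Real.cosh y := by
  rw [Real.sinh_add, cosh_rapidity hu, sinh_rapidity]
  ring

theorem energy_sinh_add_rapidity (y : ℝ) :
    energy u (Real.sinh (y + rapidity u)) = Real.cosh y := by
  rw [energy, p0_sinh, cosh_add_rapidity hu, sinh_add_rapidity hu]
  linear_combination Real.cosh y * U0_sq_sub_U1_sq hu

theorem pBracket_sinh_add_rapidity (y : ℝ) :
    pBracket u (Real.sinh (y + rapidity u)) = -(U0 u * Real.sinh y) := by
  rw [pBracket, energy_sinh_add_rapidity hu, sinh_add_rapidity hu]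
  ring

theorem gEq_sinh_add_rapidity (θ y : ℝ) :
    gEq u θ (Real.sinh (y + rapidity u)) = juttner (1 / θ) y := by
  rw [gEq, juttner, energy_sinh_add_rapidity hu, neg_mul, one_div_mul_eq_div θ]

theorem gInner_eq_rapInt {θ : ℝ} (hθ : 0 < θ) {f h : ℝ → ℝ} {F H : rapidityAlgebra}
    (hf : ∀ y, f (Real.sinh (y + rapidity u)) = juttner (1 / θ) y * (F : ℝ → ℝ) y)
    (hh : ∀ y, h (Real.sinh (y + rapidity u)) = juttner (1 / θ) y * (H : ℝ → ℝ) y) :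
    gInner u θ f h = rapidityIntegral (one_div_pos.2 hθ) (F * H) := by
  rw [gInner, integral_div_p0 fun p => 1 / gEq u θ p * f p * h p,
    ← integral_add_right_eq_self _ (rapidity u), rapidityIntegral_apply]
  refine integral_congr_ae (.of_forall fun y => ?_)
  have := juttner_pos (one_div_pos.2 hθ) y
  simp only [gEq_sinh_add_rapidity hu, hf, hh, Subalgebra.coe_mul, Pi.mul_apply]
  field_simp

end Rapidity

section RapidityBasis

/-- The functions of the rapidity with even part `e (cosh y)` and odd part `-o (cosh y) sinh y`;
the sign is that of `p_{<1>}`. -/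
def evenOdd (e o : ℝ[X]) : rapidityAlgebra := evalCosh e - evalCosh o * rapidityAlgebra.sinh

theorem evenOdd_apply (e o : ℝ[X]) (y : ℝ) : (evenOdd e o : ℝ → ℝ) y =
    e.eval (Real.cosh y) - o.eval (Real.cosh y) * Real.sinh y := by
  simp [evenOdd]

theorem cosh_mul_evenOdd (e o : ℝ[X]) : rapidityAlgebra.cosh * evenOdd e o =
    evenOdd (Polynomial.X * e) (Polynomial.X * o) := by
  have hX : evalCosh Polynomial.X = rapidityAlgebra.cosh := Polynomial.aeval_X _
  rw [evenOdd, evenOdd, map_mul, map_mul, hX]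
  ring

theorem rapidityIntegral_evenOdd_mul_evenOdd {ζ : ℝ} (hζ : 0 < ζ) (e o e' o' : ℝ[X]) :
    rapidityIntegral hζ (evenOdd e o * evenOdd e' o') =
      moment 0 hζ (e * e') + moment 1 hζ (o * o') := by
  have hodd : rapidityIntegral hζ (evalCosh (e * o' + o * e') * rapidityAlgebra.sinh) = 0 :=
    rapidityIntegral_eq_zero_of_odd hζ fun y => by simp
  rw [← sub_zero (_ + _), ← hodd, moment_apply, moment_apply, ← map_add, ← map_sub]
  congr 1
  simp only [evenOdd, map_mul, map_add]
  ring

/-- The polynomial in the energy that gives the even part of the `i`-th basis function. -/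
def evenPart (ζ : ℝ) (i : ℕ) : ℝ[X] :=
  if i = 0 ∨ i % 2 = 1 then orthoPoly 0 ζ ((i + 1) / 2) else 0

/-- The polynomial in the energy that gives the odd part of the `i`-th basis function. -/
def oddPart (ζ : ℝ) (i : ℕ) : ℝ[X] :=
  if i = 0 ∨ i % 2 = 1 then 0 else orthoPoly 1 ζ (i / 2 - 1)

/-- The basis functions divided by `g`, as functions of the rapidity in the comoving frame. -/
def rapidityBasis (ζ : ℝ) (i : ℕ) : rapidityAlgebra := evenOdd (evenPart ζ i) (oddPart ζ i)

theorem basisFn_sinh_add_rapidity {u : ℝ} (hu : |u| < 1) (θ : ℝ) (i : ℕ) (y : ℝ) :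
    basisFn i u θ (Real.sinh (y + rapidity u)) =
      juttner (1 / θ) y * (rapidityBasis (1 / θ) i : ℝ → ℝ) y := by
  have hU := (U0_pos hu).ne'
  rw [rapidityBasis, evenOdd_apply, basisFn, evenPart, oddPart]
  by_cases h0 : i = 0
  · simp [h0, basis0, gEq_sinh_add_rapidity hu, energy_sinh_add_rapidity hu]
  by_cases h1 : i % 2 = 1
  · simp [h0, h1, basis0, gEq_sinh_add_rapidity hu, energy_sinh_add_rapidity hu]
  · simp only [h0, h1, basis1, gEq_sinh_add_rapidity hu, energy_sinh_add_rapidity hu,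
      pBracket_sinh_add_rapidity hu, or_self, if_false, Polynomial.eval_zero]
    field_simp
    ring

theorem rapidityIntegral_rapidityBasis_mul {ζ : ℝ} (hζ : 0 < ζ) (i j : ℕ) :
    rapidityIntegral hζ (rapidityBasis ζ i * rapidityBasis ζ j) = if i = j then 1 else 0 := by
  have horth : ∀ ℓ m n, moment ℓ hζ (orthoPoly ℓ ζ m * orthoPoly ℓ ζ n) = if m = n then 1 else 0 :=
    fun ℓ => isOrthonormalFor_orthoSequence ℓ hζ
  rw [rapidityBasis, rapidityBasis, rapidityIntegral_evenOdd_mul_evenOdd]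
  unfold evenPart oddPart
  split_ifs <;> simp only [zero_mul, mul_zero, map_zero, horth, add_zero, zero_add] <;>
    grind

end RapidityBasis

section Gram

variable {ι : Type*} {ζ : ℝ} (hζ : 0 < ζ) (b : ι → rapidityAlgebra)

/-- The matrix of the multiplication by `m`, compressed to the span of the family `b`. -/
def gram : rapidityAlgebra →ₗ[ℝ] Matrix ι ι ℝ where
  toFun m := Matrix.of fun i j => rapidityIntegral hζ (m * b j * b i)
  map_add' m m' := by
    ext
    simp [add_mul]
  map_smul' c m := by
    ext
    simp

theorem gram_apply (m : rapidityAlgebra) (i j : ι) :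
    gram hζ b m i j = rapidityIntegral hζ (m * b j * b i) := rfl

theorem isHermitian_gram (m : rapidityAlgebra) : (gram hζ b m).IsHermitian :=
  Matrix.IsHermitian.ext fun i j => by
    rw [star_trivial, gram_apply, gram_apply, mul_right_comm]

theorem gram_mulVec [Fintype ι] (m : rapidityAlgebra) (x : ι → ℝ) (i : ι) :
    (gram hζ b m *ᵥ x) i = rapidityIntegral hζ (m * (∑ j, x j • b j) * b i) := by
  simp [mulVec, dotProduct, gram_apply, Finset.mul_sum, Finset.sum_mul, mul_comm (x _)]

theorem posSemidef_gram [Finite ι] {m : rapidityAlgebra} (hm : ∀ y, 0 ≤ (m : ℝ → ℝ) y) :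
    (gram hζ b m).PosSemidef := by
  cases nonempty_fintype ι
  refine .of_dotProduct_mulVec_nonneg (isHermitian_gram hζ b m) fun x => ?_
  have hquad : star x ⬝ᵥ gram hζ b m *ᵥ x =
      rapidityIntegral hζ (m * (∑ j, x j • b j) * ∑ i, x i • b i) := by
    simp [dotProduct, gram_mulVec, Finset.mul_sum]
  rw [hquad]
  refine rapidityIntegral_nonneg hζ fun y => ?_
  simpa [mul_assoc] using mul_nonneg (hm y) (mul_self_nonneg _)

theorem posDef_gram [Finite ι] [DecidableEq ι] (h1 : gram hζ b 1 = 1) {m : rapidityAlgebra}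
    (hm : ∀ y, 1 ≤ (m : ℝ → ℝ) y) : (gram hζ b m).PosDef := by
  rw [← add_sub_cancel 1 m, map_add, h1]
  exact Matrix.PosDef.one.add_posSemidef
    (posSemidef_gram hζ b fun y => by simpa using hm y)

end Gram

section MultiplicationMatrices

open rapidityAlgebra

/-- The matrix of the multiplication by `m`, compressed to the span of the moment basis. -/
abbrev basisGram (M : ℕ) {ζ : ℝ} (hζ : 0 < ζ) :
    rapidityAlgebra →ₗ[ℝ] Matrix (Fin (2 * M + 1)) (Fin (2 * M + 1)) ℝ :=
  gram hζ fun i => rapidityBasis ζ i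

theorem basisGram_one (M : ℕ) {ζ : ℝ} (hζ : 0 < ζ) : basisGram M hζ 1 = 1 := by
  ext i j
  rw [gram_apply, one_mul, rapidityIntegral_rapidityBasis_mul, Matrix.one_apply]
  exact if_congr (by rw [Fin.ext_iff, eq_comm]) rfl rfl

theorem basisGram_cosh_apply {M : ℕ} {ζ : ℝ} (hζ : 0 < ζ) (i j : Fin (2 * M + 1)) :
    basisGram M hζ cosh i j =
      moment 0 hζ (Polynomial.X * evenPart ζ i * evenPart ζ j) +
        moment 1 hζ (Polynomial.X * oddPart ζ i * oddPart ζ j) := by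
  rw [gram_apply, mul_right_comm, rapidityBasis, cosh_mul_evenOdd, rapidityBasis,
    rapidityIntegral_evenOdd_mul_evenOdd]

variable (M : ℕ) {u θ : ℝ} (hu : |u| < 1) (hθ : 0 < θ)
include hu

theorem matMt_eq_basisGram : matMt M u θ =
    basisGram M (one_div_pos.2 hθ) (U0 u • cosh + U1 u • sinh) := by
  ext i j
  refine gInner_eq_rapInt hu hθ (fun y => ?_) (basisFn_sinh_add_rapidity hu θ i)
  rw [p0_sinh, basisFn_sinh_add_rapidity hu, cosh_add_rapidity hu]
  simp only [Subalgebra.coe_mul, Subalgebra.coe_add, Subalgebra.coe_smul, Pi.mul_apply,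
    Pi.add_apply, Pi.smul_apply, cosh_apply, sinh_apply, smul_eq_mul]
  ring

theorem matMx_eq_basisGram : matMx M u θ =
    basisGram M (one_div_pos.2 hθ) (U0 u • sinh + U1 u • cosh) := by
  ext i j
  refine gInner_eq_rapInt hu hθ (fun y => ?_) (basisFn_sinh_add_rapidity hu θ i)
  rw [basisFn_sinh_add_rapidity hu, sinh_add_rapidity hu]
  simp only [Subalgebra.coe_mul, Subalgebra.coe_add, Subalgebra.coe_smul, Pi.mul_apply,
    Pi.add_apply, Pi.smul_apply, cosh_apply, sinh_apply, smul_eq_mul]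
  ring

include hθ in
theorem isHermitian_matMx : (matMx M u θ).IsHermitian := by
  rw [matMx_eq_basisGram M hu hθ]
  exact isHermitian_gram _ _ _

include hθ in
theorem posDef_matMt : (matMt M u θ).PosDef := by
  rw [matMt_eq_basisGram M hu hθ]
  refine posDef_gram _ _ (basisGram_one M _) fun y => ?_
  simpa [cosh_add_rapidity hu] using Real.one_le_cosh (y + rapidity u)

theorem U0_smul_matMt_sub_U1_smul_matMx : U0 u • matMt M u θ - U1 u • matMx M u θ =
    basisGram M (one_div_pos.2 hθ) cosh := by
  rw [matMt_eq_basisGram M hu hθ, matMx_eq_basisGram M hu hθ, ← map_smul, ← map_smul, ← map_sub]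
  congr 1
  calc U0 u • (U0 u • cosh + U1 u • sinh) - U1 u • (U0 u • sinh + U1 u • cosh)
    _ = (U0 u ^ 2 - U1 u ^ 2) • cosh := by module
    _ = cosh := by rw [U0_sq_sub_U1_sq hu, one_smul]

end MultiplicationMatrices

section CollisionMatrix

theorem degree_X_mul_evenPart_lt {ζ : ℝ} (hζ : 0 < ζ) {i : ℕ} (hi : i < 3) :
    (Polynomial.X * evenPart ζ i).degree < ((3 : ℕ) : WithBot ℕ) := by
  rw [mul_comm, evenPart, Polynomial.degree_mul_X]
  split_ifs
  · rw [← orthoSequence_apply 0 hζ, Polynomial.Sequence.degree_eq]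
    exact_mod_cast (by omega : (i + 1) / 2 + 1 < 3)
  · rw [Polynomial.degree_zero, WithBot.bot_add]
    exact WithBot.bot_lt_coe _

theorem degree_X_mul_oddPart_lt {ζ : ℝ} (hζ : 0 < ζ) {i : ℕ} (hi : i < 3) :
    (Polynomial.X * oddPart ζ i).degree < ((2 : ℕ) : WithBot ℕ) := by
  rw [mul_comm, oddPart, Polynomial.degree_mul_X]
  split_ifs
  · rw [Polynomial.degree_zero, WithBot.bot_add]
    exact WithBot.bot_lt_coe _
  · rw [← orthoSequence_apply 1 hζ, Polynomial.Sequence.degree_eq]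
    exact_mod_cast (by omega : i / 2 - 1 + 1 < 2)

theorem sum_univ_ite_val_lt {R : Type*} [AddCommMonoid R] {m n : ℕ} (h : m ≤ n) (f : ℕ → R) :
    ∑ i : Fin n, (if (i : ℕ) < m then f i else 0) = ∑ i ∈ Finset.range m, f i := by
  rw [Fin.sum_univ_eq_sum_range (fun i => if i < m then f i else 0), ← Finset.sum_filter]
  congr 1
  grind

variable {M : ℕ} {θ : ℝ} {j : Fin (2 * M + 1)}

theorem coeffMatrixTilde_apply_of_lt_three (hj : (j : ℕ) < 3) (i : Fin (2 * M + 1)) :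
    coeffMatrixTilde M θ i j = 0 := by
  simp only [coeffMatrixTilde, coeffMatrix, Matrix.of_apply]
  grind

theorem coeffMatrixTilde_apply_three (hj : (j : ℕ) = 3) (i : Fin (2 * M + 1)) :
    coeffMatrixTilde M θ i j = if (i : ℕ) < 5 then -(evenPart (1 / θ) i).eval 0 else 0 := by
  obtain ⟨i, _⟩ := i
  obtain ⟨j, _⟩ := j
  subst hj
  rcases i with _ | _ | _ | _ | _ | i <;> simp [coeffMatrixTilde, coeffMatrix, evenPart]

theorem coeffMatrixTilde_apply_four (hj : (j : ℕ) = 4) (i : Fin (2 * M + 1)) :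
    coeffMatrixTilde M θ i j = if (i : ℕ) < 5 then -(oddPart (1 / θ) i).eval 0 else 0 := by
  obtain ⟨i, _⟩ := i
  obtain ⟨j, _⟩ := j
  subst hj
  rcases i with _ | _ | _ | _ | _ | i <;> simp [coeffMatrixTilde, coeffMatrix, oddPart]

theorem coeffMatrixTilde_apply_of_five_le (hj : 5 ≤ (j : ℕ)) (i : Fin (2 * M + 1)) :
    coeffMatrixTilde M θ i j = if i = j then 1 else 0 := by
  simp only [coeffMatrixTilde, coeffMatrix, Matrix.of_apply]
  grind

variable (hθ : 0 < θ) {i : Fin (2 * M + 1)} (hi : (i : ℕ) < 3)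
include hi

open rapidityAlgebra

theorem basisGram_cosh_mul_coeffMatrixTilde_apply_three (hj : (j : ℕ) = 3) :
    (basisGram M (one_div_pos.2 hθ) cosh * coeffMatrixTilde M θ) i j = 0 := by
  have hζ := one_div_pos.2 hθ
  set f := Polynomial.X * evenPart (1 / θ) i with hf
  set h := Polynomial.X * oddPart (1 / θ) i
  calc (basisGram M hζ cosh * coeffMatrixTilde M θ) i j
    _ = ∑ k ∈ Finset.range 5, (moment 0 hζ (f * evenPart (1 / θ) k) +
        moment 1 hζ (h * oddPart (1 / θ) k)) * -(evenPart (1 / θ) k).eval 0 := by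
      rw [← sum_univ_ite_val_lt (n := 2 * M + 1) (by omega), Matrix.mul_apply]
      simp only [coeffMatrixTilde_apply_three hj, basisGram_cosh_apply, mul_ite, mul_zero, f, h]
    _ = -∑ n ∈ Finset.range 3, moment 0 hζ (f * orthoPoly 0 (1 / θ) n) *
        (orthoPoly 0 (1 / θ) n).eval 0 := by
      simp [Finset.sum_range_succ, evenPart, oddPart]
    _ = -f.eval 0 := congrArg _ ((isOrthonormalFor_orthoSequence 0 hζ).sum_mul_eval_eq
      (degree_X_mul_evenPart_lt hζ hi) 0)
    _ = 0 := by simp [hf]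

theorem basisGram_cosh_mul_coeffMatrixTilde_apply_four (hj : (j : ℕ) = 4) :
    (basisGram M (one_div_pos.2 hθ) cosh * coeffMatrixTilde M θ) i j = 0 := by
  have hζ := one_div_pos.2 hθ
  set f := Polynomial.X * evenPart (1 / θ) i
  set h := Polynomial.X * oddPart (1 / θ) i with hh
  calc (basisGram M hζ cosh * coeffMatrixTilde M θ) i j
    _ = ∑ k ∈ Finset.range 5, (moment 0 hζ (f * evenPart (1 / θ) k) +
        moment 1 hζ (h * oddPart (1 / θ) k)) * -(oddPart (1 / θ) k).eval 0 := by
      rw [← sum_univ_ite_val_lt (n := 2 * M + 1) (by omega), Matrix.mul_apply]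
      simp only [coeffMatrixTilde_apply_four hj, basisGram_cosh_apply, mul_ite, mul_zero, f, h]
    _ = -∑ n ∈ Finset.range 2, moment 1 hζ (h * orthoPoly 1 (1 / θ) n) *
        (orthoPoly 1 (1 / θ) n).eval 0 := by
      simp [Finset.sum_range_succ, evenPart, oddPart]
    _ = -h.eval 0 := congrArg _ ((isOrthonormalFor_orthoSequence 1 hζ).sum_mul_eval_eq
      (degree_X_mul_oddPart_lt hζ hi) 0)
    _ = 0 := by simp [hh]

theorem basisGram_cosh_apply_of_five_le {ζ : ℝ} (hζ : 0 < ζ) (hj : 5 ≤ (j : ℕ)) :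
    basisGram M hζ cosh i j = 0 := by
  rw [basisGram_cosh_apply, evenPart.eq_def ζ j, oddPart.eq_def ζ j]
  split_ifs
  · rw [mul_zero, map_zero, add_zero]
    exact (isOrthonormalFor_orthoSequence 0 hζ).apply_mul_eq_zero
      ((degree_X_mul_evenPart_lt hζ hi).trans_le (Nat.cast_le.2 (by omega)))
  · rw [mul_zero, map_zero, zero_add]
    exact (isOrthonormalFor_orthoSequence 1 hζ).apply_mul_eq_zero
      ((degree_X_mul_oddPart_lt hζ hi).trans_le (Nat.cast_le.2 (by omega)))

theorem basisGram_cosh_mul_coeffMatrixTilde_apply_of_lt_three (j : Fin (2 * M + 1)) :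
    (basisGram M (one_div_pos.2 hθ) cosh * coeffMatrixTilde M θ) i j = 0 := by
  obtain hj | hj | hj | hj : (j : ℕ) < 3 ∨ (j : ℕ) = 3 ∨ (j : ℕ) = 4 ∨ 5 ≤ (j : ℕ) := by omega
  · simp [Matrix.mul_apply, coeffMatrixTilde_apply_of_lt_three hj]
  · exact basisGram_cosh_mul_coeffMatrixTilde_apply_three hθ hi hj
  · exact basisGram_cosh_mul_coeffMatrixTilde_apply_four hθ hi hj
  · simp [Matrix.mul_apply, coeffMatrixTilde_apply_of_five_le hj,
      basisGram_cosh_apply_of_five_le hi _ hj]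

end CollisionMatrix

section EquilibriumDerivatives

theorem hasDerivAt_energy_left {u : ℝ} (hu : |u| < 1) (p : ℝ) :
    HasDerivAt (fun s => energy s p) (U0 u * pBracket u p) u := by
  have h := one_sub_sq_pos hu
  have hsqrt : HasDerivAt (fun s : ℝ => √(1 - s ^ 2)) (-u / √(1 - u ^ 2)) u := by
    refine ((hasDerivAt_pow 2 u).const_sub 1).sqrt h.ne' |>.congr_deriv ?_
    simp only [Nat.cast_ofNat, Nat.add_one_sub_one, pow_one]
    ring
  have hU0 := (hasDerivAt_const u (1 : ℝ)).fun_div hsqrt (Real.sqrt_pos.2 h).ne'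
  have hU1 := (hasDerivAt_id' u).fun_div hsqrt (Real.sqrt_pos.2 h).ne'
  refine ((hU0.mul_const (p0 p)).sub (hU1.mul_const p)).congr_deriv ?_
  simp only [pBracket, energy, U0, U1]
  field_simp [(Real.sqrt_pos.2 h).ne']
  ring

theorem hasDerivAt_gEq_left {u : ℝ} (hu : |u| < 1) (θ p : ℝ) :
    HasDerivAt (fun s => gEq s θ p) (-(U0 u / θ) * (gEq u θ p * pBracket u p)) u := by
  refine (((hasDerivAt_energy_left hu p).div_const θ).fun_neg.exp.const_mul _).congr_deriv ?_
  rw [gEq]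
  ring

theorem exists_hasDerivAt_gEq_right (u : ℝ) {θ : ℝ} (hθ : 0 < θ) :
    ∃ κ : ℝ, ∀ p, HasDerivAt (fun s => gEq u s p)
      (gEq u θ p * (1 / θ ^ 2 * energy u p + κ)) θ := by
  have hK := besselK_one_pos (one_div_pos.2 hθ)
  have hnorm : DifferentiableAt ℝ (fun s => 1 / (2 * besselK 1 (1 / s))) θ := by
    have hinv : DifferentiableAt ℝ (fun s : ℝ => 1 / s) θ := by fun_prop (disch := exact hθ.ne')
    have hcomp := (differentiableAt_besselK_one (one_div_pos.2 hθ)).comp θ hinv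
    exact (differentiableAt_const 1).fun_div (hcomp.const_mul 2) (by simpa using hK.ne')
  refine ⟨deriv (fun s => 1 / (2 * besselK 1 (1 / s))) θ * (2 * besselK 1 (1 / θ)), fun p => ?_⟩
  have hexp := ((hasDerivAt_const θ (energy u p)).fun_div (hasDerivAt_id' θ) hθ.ne').fun_neg.exp
  refine (hnorm.hasDerivAt.mul hexp).congr_deriv ?_
  rw [gEq]
  field_simp
  ring

end EquilibriumDerivatives

section Equilibrium

variable {M : ℕ}

theorem val_one_fin (hM : 1 ≤ M) : ((1 : Fin (2 * M + 1)) : ℕ) = 1 :=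
  Nat.mod_eq_of_lt (show 1 < 2 * M + 1 by omega)

theorem val_two_fin (hM : 1 ≤ M) : ((2 : Fin (2 * M + 1)) : ℕ) = 2 :=
  Nat.mod_eq_of_lt (show 2 < 2 * M + 1 by omega)

theorem equilibrium_zero (ρ u θ : ℝ) : equilibrium M ρ u θ 0 = ρ := rfl

theorem equilibrium_one (hM : 1 ≤ M) (ρ u θ : ℝ) : equilibrium M ρ u θ 1 = u := by
  simp only [equilibrium, val_one_fin hM]

theorem equilibrium_two (hM : 1 ≤ M) (ρ u θ : ℝ) : equilibrium M ρ u θ 2 = θ := by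
  simp only [equilibrium, val_two_fin hM]

theorem update_equilibrium_zero (ρ u θ s : ℝ) :
    Function.update (equilibrium M ρ u θ) 0 s = equilibrium M s u θ :=
  Function.update_eq_iff.2 ⟨rfl, fun i hi => by
    grind [equilibrium, Fin.ext_iff, Fin.val_zero]⟩

theorem update_equilibrium_one (hM : 1 ≤ M) (ρ u θ s : ℝ) :
    Function.update (equilibrium M ρ u θ) 1 s = equilibrium M ρ s θ :=
  Function.update_eq_iff.2 ⟨(equilibrium_one hM ..).symm, fun i hi => by
    grind [equilibrium, Fin.ext_iff, val_one_fin hM]⟩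

theorem update_equilibrium_two (hM : 1 ≤ M) (ρ u θ s : ℝ) :
    Function.update (equilibrium M ρ u θ) 2 s = equilibrium M ρ u s :=
  Function.update_eq_iff.2 ⟨(equilibrium_two hM ..).symm, fun i hi => by
    grind [equilibrium, Fin.ext_iff, val_two_fin hM]⟩

theorem eval_orthoPoly_zero (ℓ : ℕ) (ζ x : ℝ) :
    (orthoPoly ℓ ζ 0).eval x = (orthoPoly ℓ ζ 0).leadingCoeff := by
  rw [orthoPoly]
  simp

theorem leadingCoeff_orthoPoly_zero_ne_zero (ℓ : ℕ) {ζ : ℝ} (hζ : 0 < ζ) :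
    (orthoPoly ℓ ζ 0).leadingCoeff ≠ 0 :=
  eval_orthoPoly_zero ℓ ζ 0 ▸ eval_zero_orthoPoly_ne_zero ℓ hζ 0

theorem exists_smul_orthoPoly_add_smul_orthoPoly_eq (ℓ : ℕ) {ζ : ℝ} (hζ : 0 < ζ) {a : ℝ}
    (ha : a ≠ 0) (b : ℝ) : ∃ α β : ℝ, β ≠ 0 ∧ ∀ x,
      α * (orthoPoly ℓ ζ 0).eval x + β * (orthoPoly ℓ ζ 1).eval x = a * x + b := by
  have hc := leadingCoeff_orthoPoly_zero_ne_zero ℓ hζ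
  have hdeg : (orthoPoly ℓ ζ 1).natDegree = 1 := (orthoSequence ℓ hζ).natDegree_eq 1
  obtain ⟨s, hs, t, hst⟩ := Polynomial.natDegree_eq_one.1 hdeg
  refine ⟨(b - a / s * t) / (orthoPoly ℓ ζ 0).leadingCoeff, a / s, div_ne_zero ha hs, fun x => ?_⟩
  rw [← hst, eval_orthoPoly_zero]
  simp only [Polynomial.eval_add, Polynomial.eval_mul, Polynomial.eval_C, Polynomial.eval_X]
  field_simp
  ring

theorem basisFn_zero (u θ p : ℝ) :
    basisFn 0 u θ p = gEq u θ p * (orthoPoly 0 (1 / θ) 0).leadingCoeff := by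
  rw [basisFn, if_pos rfl, basis0, eval_orthoPoly_zero]

theorem basisFn_two (u θ p : ℝ) : basisFn 2 u θ p =
    gEq u θ p * (U0 u)⁻¹ * (orthoPoly 1 (1 / θ) 0).leadingCoeff * pBracket u p := by
  simp [basisFn, basis1, eval_orthoPoly_zero]

theorem coeffMatrix_apply_of_lt_three {θ : ℝ} {i j : Fin (2 * M + 1)} (hj : (j : ℕ) < 3) :
    coeffMatrix M θ i j =
      if i = 0 ∧ j = 0 then ((orthoPoly 0 (1 / θ) 0).leadingCoeff)⁻¹ else 0 := by
  simp only [coeffMatrix, Matrix.of_apply, Fin.ext_iff, Fin.val_zero]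
  grind

theorem equilibrium_of_three_le {j : Fin (2 * M + 1)} (hj : 3 ≤ (j : ℕ)) (ρ u θ : ℝ) :
    equilibrium M ρ u θ j = 0 := by
  grind [equilibrium]

theorem coeffMatrix_mulVec_equilibrium (ρ u θ θ' : ℝ) :
    coeffMatrix M θ' *ᵥ equilibrium M ρ u θ =
      Pi.single 0 (((orthoPoly 0 (1 / θ') 0).leadingCoeff)⁻¹ * ρ) := by
  funext i
  rw [mulVec, dotProduct, Finset.sum_eq_single 0 (fun j _ hj => ?_) (by simp), equilibrium_zero,
    coeffMatrix_apply_of_lt_three (by simp), Pi.single_apply]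
  · simp
  · obtain h | h := lt_or_ge (j : ℕ) 3
    · rw [coeffMatrix_apply_of_lt_three h, if_neg fun h => hj h.2, zero_mul]
    · rw [equilibrium_of_three_le h, mul_zero]

theorem ansatz_equilibrium (hM : 1 ≤ M) {θ : ℝ} (hθ : 0 < θ) (ρ u p : ℝ) :
    ansatz M (equilibrium M ρ u θ) p = ρ * gEq u θ p := by
  have hc := leadingCoeff_orthoPoly_zero_ne_zero 0 (one_div_pos.2 hθ)
  simp only [ansatz, equilibrium_one hM, equilibrium_two hM, coeffMatrix_mulVec_equilibrium,
    Pi.single_apply, ite_mul, zero_mul, Finset.sum_ite_eq', Finset.mem_univ, if_true,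
    Fin.val_zero, basisFn_zero]
  field_simp

theorem deriv_ansatz_zero (hM : 1 ≤ M) {θ : ℝ} (hθ : 0 < θ) (ρ u p : ℝ) :
    deriv (fun s => ansatz M (Function.update (equilibrium M ρ u θ) 0 s) p) ρ =
      ((orthoPoly 0 (1 / θ) 0).leadingCoeff)⁻¹ * basisFn 0 u θ p := by
  have hc := leadingCoeff_orthoPoly_zero_ne_zero 0 (one_div_pos.2 hθ)
  simp only [update_equilibrium_zero, ansatz_equilibrium hM hθ]
  rw [((hasDerivAt_id' ρ).mul_const _).deriv, basisFn_zero]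
  field_simp

theorem deriv_ansatz_one (hM : 1 ≤ M) {u θ : ℝ} (hu : |u| < 1) (hθ : 0 < θ) (ρ p : ℝ) :
    deriv (fun s => ansatz M (Function.update (equilibrium M ρ u θ) 1 s) p) u =
      -(ρ * U0 u ^ 2 / (θ * (orthoPoly 1 (1 / θ) 0).leadingCoeff)) * basisFn 2 u θ p := by
  have hc := leadingCoeff_orthoPoly_zero_ne_zero 1 (one_div_pos.2 hθ)
  have hU := (U0_pos hu).ne'
  simp only [update_equilibrium_one hM, ansatz_equilibrium hM hθ]
  rw [((hasDerivAt_gEq_left hu θ p).const_mul ρ).deriv, basisFn_two]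
  field_simp

theorem exists_deriv_ansatz_two (hM : 1 ≤ M) (u : ℝ) {ρ θ : ℝ} (hρ : ρ ≠ 0) (hθ : 0 < θ) :
    ∃ α β : ℝ, β ≠ 0 ∧ ∀ p,
      deriv (fun s => ansatz M (Function.update (equilibrium M ρ u θ) 2 s) p) θ =
        α * basisFn 0 u θ p + β * basisFn 1 u θ p := by
  obtain ⟨κ, hκ⟩ := exists_hasDerivAt_gEq_right u hθ
  obtain ⟨α, β, hβ, hαβ⟩ := exists_smul_orthoPoly_add_smul_orthoPoly_eq 0 (one_div_pos.2 hθ)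
    (one_div_ne_zero (pow_ne_zero 2 hθ.ne')) κ
  refine ⟨ρ * α, ρ * β, mul_ne_zero hρ hβ, fun p => ?_⟩
  have hder := ((hκ p).const_mul ρ).congr_of_eventuallyEq
    (f₁ := fun s => ansatz M (Function.update (equilibrium M ρ u θ) 2 s) p) (by
      filter_upwards [Ioi_mem_nhds hθ] with s hs
      rw [update_equilibrium_two hM, ansatz_equilibrium hM hs])
  rw [hder.deriv, ← hαβ]
  simp only [basisFn, basis0, if_true, one_ne_zero, if_false]
  ring

theorem deriv_ansatz_of_ne {j : Fin (2 * M + 1)} (h1 : j ≠ 1) (h2 : j ≠ 2)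
    (W : Fin (2 * M + 1) → ℝ) (p : ℝ) :
    deriv (fun s => ansatz M (Function.update W j s) p) (W j) =
      ∑ i, coeffMatrix M (W 2) i j * basisFn i (W 1) (W 2) p := by
  have hupdate : HasDerivAt (Function.update W j) (Pi.single j 1) (W j) := hasDerivAt_update W j _
  have hmul : HasDerivAt (fun s => coeffMatrix M (W 2) *ᵥ Function.update W j s)
      (coeffMatrix M (W 2) *ᵥ Pi.single j 1) (W j) :=
    (coeffMatrix M (W 2)).mulVecLin.toContinuousLinearMap.hasFDerivAt.comp_hasDerivAt _ hupdate
  simp only [ansatz, Function.update_of_ne h1.symm, Function.update_of_ne h2.symm]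
  refine (HasDerivAt.fun_sum fun i _ => (hasDerivAt_pi.1 hmul i).mul_const _).deriv.trans ?_
  simp only [mulVec_single_one, col_apply]

end Equilibrium

section DerivativeMatrix

variable {M : ℕ}

theorem matD_apply_of_deriv_eq_sum {W : Fin (2 * M + 1) → ℝ} (hu : |W 1| < 1) (hθ : 0 < W 2)
    {j : Fin (2 * M + 1)} {d : Fin (2 * M + 1) → ℝ}
    (h : ∀ p, deriv (fun s => ansatz M (Function.update W j s) p) (W j) =
      ∑ k, d k * basisFn k (W 1) (W 2) p) (i : Fin (2 * M + 1)) : matD M W i j = d i := by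
  have hζ := one_div_pos.2 hθ
  calc matD M W i j
    _ = rapidityIntegral hζ
        ((∑ k, d k • rapidityBasis (1 / W 2) k) * rapidityBasis (1 / W 2) i) := by
      refine gInner_eq_rapInt hu hθ (fun y => ?_) (basisFn_sinh_add_rapidity hu _ i)
      simp only [h, basisFn_sinh_add_rapidity hu, AddSubmonoidClass.coe_finsetSum,
        Finset.sum_apply, Subalgebra.coe_smul, Pi.smul_apply, smul_eq_mul, Finset.mul_sum,
        mul_left_comm]
    _ = d i := by
      simp [Finset.sum_mul, rapidityIntegral_rapidityBasis_mul, Fin.val_inj]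

/-- The columns of `matD` at local equilibrium that stem from `ρ`, `u` and `θ`: these derivatives
are combinations of `P̃⁽⁰⁾_0`, `P̃⁽⁰⁾_1` and `P̃⁽¹⁾_0`. -/
def fluidBlock (M : ℕ) (r₀ r₁ α β : ℝ) : Matrix (Fin (2 * M + 1)) (Fin (2 * M + 1)) ℝ :=
  Matrix.of fun i j =>
    match (i : ℕ), (j : ℕ) with
    | 0, 0 => r₀
    | 2, 1 => r₁
    | 0, 2 => α
    | 1, 2 => β
    | _, _ => 0

variable {r₀ r₁ α β : ℝ}

theorem fluidBlock_apply_of_three_le_left {i : Fin (2 * M + 1)} (hi : 3 ≤ (i : ℕ))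
    (j : Fin (2 * M + 1)) : fluidBlock M r₀ r₁ α β i j = 0 := by
  simp only [fluidBlock, Matrix.of_apply]
  grind

theorem sum_fluidBlock_mul (hM : 1 ≤ M) (j : Fin (2 * M + 1)) (f : ℕ → ℝ) :
    ∑ i, fluidBlock M r₀ r₁ α β i j * f i =
      match (j : ℕ) with
      | 0 => r₀ * f 0
      | 1 => r₁ * f 2
      | 2 => α * f 0 + β * f 1
      | _ => 0 := by
  have hlt (i : Fin (2 * M + 1)) : fluidBlock M r₀ r₁ α β i j * f i =
      if (i : ℕ) < 3 then fluidBlock M r₀ r₁ α β (Fin.ofNat _ i) j * f i else 0 := by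
    split_ifs with hi
    · rw [Fin.ofNat_val_eq_self]
    · rw [fluidBlock_apply_of_three_le_left (not_lt.1 hi), zero_mul]
  rw [Finset.sum_congr rfl fun i _ => hlt i, sum_univ_ite_val_lt (m := 3) (by omega)
    fun i => fluidBlock M r₀ r₁ α β (Fin.ofNat _ i) j * f i]
  simp only [Finset.sum_range_succ, Finset.sum_range_zero, fluidBlock, Matrix.of_apply,
    Fin.val_ofNat, Nat.mod_eq_of_lt (show 0 < 2 * M + 1 by omega),
    Nat.mod_eq_of_lt (show 1 < 2 * M + 1 by omega), Nat.mod_eq_of_lt (show 2 < 2 * M + 1 by omega)]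
  rcases (j : ℕ) with _ | _ | _ | j <;> simp

theorem exists_matD_equilibrium (hM : 1 ≤ M) {ρ u θ : ℝ} (hρ : 0 < ρ) (hu : |u| < 1)
    (hθ : 0 < θ) : ∃ r₀ r₁ α β : ℝ, r₀ ≠ 0 ∧ r₁ ≠ 0 ∧ β ≠ 0 ∧
      matD M (equilibrium M ρ u θ) = coeffMatrixTilde M θ + fluidBlock M r₀ r₁ α β := by
  have hζ := one_div_pos.2 hθ
  have hc₀ := leadingCoeff_orthoPoly_zero_ne_zero 0 hζ
  have hc₁ := leadingCoeff_orthoPoly_zero_ne_zero 1 hζ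
  have hU := (U0_pos hu).ne'
  obtain ⟨α, β, hβ, hαβ⟩ := exists_deriv_ansatz_two hM u hρ.ne' hθ
  refine ⟨((orthoPoly 0 (1 / θ) 0).leadingCoeff)⁻¹,
    -(ρ * U0 u ^ 2 / (θ * (orthoPoly 1 (1 / θ) 0).leadingCoeff)), α, β,
    by positivity, neg_ne_zero.2 (by positivity), hβ, ?_⟩
  ext i j
  refine matD_apply_of_deriv_eq_sum
    (d := fun i => (coeffMatrixTilde M θ + fluidBlock M _ _ α β) i j)
    ((equilibrium_one hM ρ u θ).symm ▸ hu) ((equilibrium_two hM ρ u θ).symm ▸ hθ) (fun p => ?_) i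
  rw [equilibrium_one hM, equilibrium_two hM]
  simp only [Matrix.add_apply, add_mul, Finset.sum_add_distrib]
  rw [sum_fluidBlock_mul hM j fun i => basisFn i u θ p]
  obtain hj | hj := lt_or_ge (j : ℕ) 3
  · simp only [coeffMatrixTilde_apply_of_lt_three hj, zero_mul, Finset.sum_const_zero, zero_add]
    obtain rfl | rfl | rfl : j = 0 ∨ j = 1 ∨ j = 2 := by
      grind [Fin.ext_iff, val_one_fin hM, val_two_fin hM]
    · rw [Fin.val_zero]
      exact deriv_ansatz_zero hM hθ ρ u p
    · rw [equilibrium_one hM, val_one_fin hM]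
      exact deriv_ansatz_one hM hu hθ ρ p
    · rw [equilibrium_two hM, val_two_fin hM]
      exact hαβ p
  · have h1 : j ≠ 1 := fun h => by rw [h, val_one_fin hM] at hj; omega
    have h2 : j ≠ 2 := fun h => by rw [h, val_two_fin hM] at hj; omega
    have hcoeff i : coeffMatrixTilde M θ i j = coeffMatrix M θ i j :=
      if_neg fun h => by omega
    rw [deriv_ansatz_of_ne h1 h2, equilibrium_one hM, equilibrium_two hM]
    simp only [hcoeff]
    grind

theorem isUpperTriangular_coeffMatrixTilde (θ : ℝ) :
    (coeffMatrixTilde M θ).BlockTriangular id := fun i j (hij : j < i) => by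
  simp only [coeffMatrixTilde, coeffMatrix, Matrix.of_apply]
  grind

theorem coeffMatrixTilde_apply_self_ne_zero {θ : ℝ} (hθ : 0 < θ) {i : Fin (2 * M + 1)}
    (hi : 3 ≤ (i : ℕ)) : coeffMatrixTilde M θ i i ≠ 0 := by
  have hζ := one_div_pos.2 hθ
  have := eval_zero_orthoPoly_ne_zero 0 hζ 2
  have := eval_zero_orthoPoly_ne_zero 1 hζ 1
  simp only [coeffMatrixTilde, coeffMatrix, Matrix.of_apply]
  grind

theorem val_swap_one_two (hM : 1 ≤ M) (j : Fin (2 * M + 1)) :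
    ((Equiv.swap (1 : Fin (2 * M + 1)) 2 j : Fin (2 * M + 1)) : ℕ) =
      if (j : ℕ) = 1 then 2 else if (j : ℕ) = 2 then 1 else (j : ℕ) := by
  grind [Fin.ext_iff, val_one_fin hM, val_two_fin hM]

theorem isUpperTriangular_fluidBlock_submatrix_swap (hM : 1 ≤ M) :
    ((fluidBlock M r₀ r₁ α β).submatrix id (Equiv.swap 1 2)).BlockTriangular id :=
  fun i j (hij : j < i) => by
    simp only [fluidBlock, submatrix_apply, Matrix.of_apply, val_swap_one_two hM, id]
    grind

theorem fluidBlock_apply_swap_self_ne_zero (hM : 1 ≤ M) (h₀ : r₀ ≠ 0) (h₁ : r₁ ≠ 0) (hβ : β ≠ 0)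
    {i : Fin (2 * M + 1)} (hi : (i : ℕ) < 3) :
    fluidBlock M r₀ r₁ α β i (Equiv.swap 1 2 i) ≠ 0 := by
  simp only [fluidBlock, Matrix.of_apply, val_swap_one_two hM]
  grind

theorem coeffMatrixTilde_submatrix_swap (hM : 1 ≤ M) (θ : ℝ) :
    (coeffMatrixTilde M θ).submatrix id (Equiv.swap 1 2) = coeffMatrixTilde M θ := by
  ext i j
  have hj := val_swap_one_two hM j
  obtain h | h := lt_or_ge (j : ℕ) 3
  · rw [submatrix_apply, coeffMatrixTilde_apply_of_lt_three h,
      coeffMatrixTilde_apply_of_lt_three (by grind)]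
  · rw [submatrix_apply, id, show Equiv.swap 1 2 j = j from Fin.ext (by grind)]

theorem det_coeffMatrixTilde_add_fluidBlock_ne_zero (hM : 1 ≤ M) {θ : ℝ} (hθ : 0 < θ)
    (h₀ : r₀ ≠ 0) (h₁ : r₁ ≠ 0) (hβ : β ≠ 0) :
    (coeffMatrixTilde M θ + fluidBlock M r₀ r₁ α β).det ≠ 0 := by
  -- Exchanging the columns of `u` and `θ` makes the matrix upper triangular.
  set D := coeffMatrixTilde M θ + fluidBlock M r₀ r₁ α β
  have hswap : D.submatrix id (Equiv.swap 1 2) =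
      coeffMatrixTilde M θ + (fluidBlock M r₀ r₁ α β).submatrix id (Equiv.swap 1 2) := by
    conv_rhs => rw [← coeffMatrixTilde_submatrix_swap hM]
    rfl
  have hdet := det_permute' (Equiv.swap 1 2) D
  rw [hswap, det_of_isUpperTriangular ((isUpperTriangular_coeffMatrixTilde θ).add
    (isUpperTriangular_fluidBlock_submatrix_swap hM))] at hdet
  refine right_ne_zero_of_mul (hdet ▸ Finset.prod_ne_zero_iff.2 fun i _ => ?_)
  rw [Matrix.add_apply, submatrix_apply, id]
  obtain hi | hi := lt_or_ge (i : ℕ) 3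
  · rw [coeffMatrixTilde_apply_of_lt_three hi, zero_add]
    exact fluidBlock_apply_swap_self_ne_zero hM h₀ h₁ hβ hi
  · rw [fluidBlock_apply_of_three_le_left hi, add_zero]
    exact coeffMatrixTilde_apply_self_ne_zero hθ hi

end DerivativeMatrix

section Symmetrization

variable {M : ℕ} {ρ u θ : ℝ}

open rapidityAlgebra in
theorem transpose_fluidBlock_mul_basisGram_cosh_mul_coeffMatrixTilde (hθ : 0 < θ)
    (r₀ r₁ α β : ℝ) : (fluidBlock M r₀ r₁ α β)ᵀ *
      (basisGram M (one_div_pos.2 hθ) cosh * coeffMatrixTilde M θ) = 0 := by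
  ext i j
  rw [Matrix.mul_apply]
  refine Finset.sum_eq_zero fun k _ => ?_
  obtain hk | hk := lt_or_ge (k : ℕ) 3
  · rw [basisGram_cosh_mul_coeffMatrixTilde_apply_of_lt_three hθ hk, mul_zero]
  · rw [transpose_apply, fluidBlock_apply_of_three_le_left hk, zero_mul]

variable (hM : 1 ≤ M) (hu : |u| < 1) (hθ : 0 < θ)
include hM hu hθ

theorem isHermitian_transpose_matD_mul_matB1 :
    ((matD M (equilibrium M ρ u θ))ᵀ * matB1 M (equilibrium M ρ u θ)).IsHermitian := by
  rw [matB1, equilibrium_one hM, equilibrium_two hM, ← conjTranspose_eq_transpose_of_trivial,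
    ← Matrix.mul_assoc]
  exact isHermitian_conjTranspose_mul_mul _ (isHermitian_matMx M hu hθ)

variable (hρ : 0 < ρ)
include hρ

theorem isUnit_matD_equilibrium : IsUnit (matD M (equilibrium M ρ u θ)) := by
  obtain ⟨r₀, r₁, α, β, h₀, h₁, hβ, hD⟩ := exists_matD_equilibrium hM hρ hu hθ
  rw [isUnit_iff_isUnit_det, isUnit_iff_ne_zero, hD]
  exact det_coeffMatrixTilde_add_fluidBlock_ne_zero hM hθ h₀ h₁ hβ

theorem posDef_transpose_matD_mul_matB0 :
    ((matD M (equilibrium M ρ u θ))ᵀ * matB0 M (equilibrium M ρ u θ)).PosDef := by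
  rw [matB0, equilibrium_one hM, equilibrium_two hM, ← conjTranspose_eq_transpose_of_trivial,
    ← Matrix.mul_assoc]
  exact (posDef_matMt M hu hθ).conjTranspose_mul_mul_same
    (mulVec_injective_of_isUnit (isUnit_matD_equilibrium hM hu hθ hρ))

theorem posSemidef_neg_transpose_matD_mul_matQ {τ : ℝ → ℝ → ℝ} (hτ : 0 < τ ρ θ) :
    (-((matD M (equilibrium M ρ u θ))ᵀ * matQ M τ (equilibrium M ρ u θ))).PosSemidef := by
  obtain ⟨r₀, r₁, α, β, -, -, -, hD⟩ := exists_matD_equilibrium hM hρ hu hθ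
  set A := basisGram M (one_div_pos.2 hθ) rapidityAlgebra.cosh
  set N := coeffMatrixTilde M θ
  have hA : A.PosSemidef := posSemidef_gram _ _ fun y => (Real.cosh_pos y).le
  have hS : -((matD M (equilibrium M ρ u θ))ᵀ * matQ M τ (equilibrium M ρ u θ)) =
      (1 / τ ρ θ) • (Nᴴ * A * N) := by
    rw [matQ, equilibrium_zero, equilibrium_one hM, equilibrium_two hM,
      U0_smul_matMt_sub_U1_smul_matMx M hu hθ, hD, transpose_add, mul_smul_comm, add_mul,
      transpose_fluidBlock_mul_basisGram_cosh_mul_coeffMatrixTilde hθ, add_zero, neg_smul, neg_neg,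
      conjTranspose_eq_transpose_of_trivial, Matrix.mul_assoc]
  rw [hS]
  exact (hA.conjTranspose_mul_mul_same N).smul (one_div_pos.2 hτ).le

open scoped ComplexOrder in
theorem DispersionRelation.exists_symmetrization {τ : ℝ → ℝ → ℝ} (hτ : 0 < τ ρ θ) {ω k : ℂ}
    (h : DispersionRelation M τ (equilibrium M ρ u θ) ω k) :
    ∃ P H S : Matrix (Fin (2 * M + 1)) (Fin (2 * M + 1)) ℂ,
      P.PosDef ∧ H.IsHermitian ∧ S.PosSemidef ∧
        ((Complex.I * ω) • P - (Complex.I * k) • H + S).det = 0 :=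
  ⟨_, _, _, posDef_map_ofReal (posDef_transpose_matD_mul_matB0 hM hu hθ hρ),
    (isHermitian_transpose_matD_mul_matB1 hM hu hθ).map _ fun x => (Complex.conj_ofReal x).symm,
    posSemidef_map_ofReal (posSemidef_neg_transpose_matD_mul_matQ hM hu hθ hρ hτ),
    det_symmetrized_eq_zero h⟩

end Symmetrization

end RelMoment
end

theorem mainTheorem4 (M : ℕ) (hM : 1 ≤ M) (τ : ℝ → ℝ → ℝ) (ρ₀ u₀ θ₀ : ℝ)
    (hρ : 0 < ρ₀) (hu : |u₀| < 1) (hθ : 0 < θ₀) (hτ : 0 < τ ρ₀ θ₀) :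
    (∀ (k : ℝ) (ω : ℂ),
      RelMoment.DispersionRelation M τ (RelMoment.equilibrium M ρ₀ u₀ θ₀) ω (k : ℂ) →
        0 ≤ ω.im) ∧
    (∀ (ω : ℝ) (k : ℂ), 0 < ω →
      RelMoment.DispersionRelation M τ (RelMoment.equilibrium M ρ₀ u₀ θ₀) (ω : ℂ) k →
        k.re * k.im ≤ 0) := by
  refine ⟨fun k ω h => ?_, fun ω k hω h => ?_⟩
  · obtain ⟨P, H, S, hP, hH, hS, hdet⟩ := h.exists_symmetrization hM hu hθ hρ hτ
    exact RelMoment.im_nonneg_of_det_eq_zero hP hH hS hdet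
  · obtain ⟨P, H, S, hP, hH, hS, hdet⟩ := h.exists_symmetrization hM hu hθ hρ hτ
    exact RelMoment.re_mul_im_nonpos_of_det_eq_zero hP hH hS hω hdet
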